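/- Let $f_0:[0,1]\to\mathbb R$ satisfy $f_0(r)=\tilde f_0(r^2)$ with $\tilde f_0\in\mathscr C^{2,\beta}([0,1])$ for some $\beta\in(0,1)$, $\inf_{r\in(0,1]}\frac{f_0'(r)}{r}>0$, and $f_0<0$ on $[0,1]$. Put $$\kappa_1=\inf_{r\in[0,1]}\int_0^1 s f_0(rs)\,ds,\qquad \kappa_2=\sup_{r\in[0,1]}\int_0^1 s f_0(rs)\,ds,$$ $$\widehat\Omega_n=\int_0^1 s f_0(s)\,ds-\frac{n+1}{n}\int_0^1 s^{2n+1}f_0(s)\,ds\qquad(n\ge1).$$ For $\Omega\in\mathbb R\setminus[\kappa_1,\kappa_2]$ let $\sigma_\Omega=-1$ if $\Omega<\kappa_1$, $\sigma_\Omega=1$ if $\Omega>\kappa_2$, and $$\nu_\Omega(r)=\sigma_\Omega\,\frac{f_0'(r)}{r\left(\Omega-\int_0^1 s f_0(sr)\,ds\right)}\qquad (r\in(0,1]).$$ For $n\ge1$ let $F_{n,\Omega}$ be the unique solution of class $\mathscr C^2$ on $[0,1]$ of $$F''+\frac{2n+1}{r}F'+\sigma_\Omega\nu_\Omega F=0\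 \text{ on }(0,1),\qquad F(0)=1,$$ and set $$\zeta_n(\Omega)=F_{n,\Omega}(1)\left(\Omega-\frac{n}{n+1}\int_0^1 s f_0(s)\,ds\right)+\int_0^1F_{n,\Omega}(s)\,s^{2n+1}\big(f_0(s)-2\Omega\big)\,ds.$$ Let $\alpha\in(1,2)$. Then there is an integer $m_0\ge1$, depending only on $f_0$ and $\alpha$, such that for every integer $m\ge m_0$ there exists $$\Omega_m\in(\widehat\Omega_m-m^{-\alpha},\widehat\Omega_m)$$ with $\Omega_m>\kappa_2$ (for this $\Omega_m$ and all $n\ge1$, the solution $F_{nm,\Omega_m}$ exists and is unique, so that $\zeta_{nm}(\Omega_m)$ is defined) such that 1. $\zeta_m(\Omega_m)=0$; 2. $\Omega_m\neq\widehat\Omega_{nm}$ for all $n\ge1$; 3. $\zeta_{nm}(\Omega_m)\neq0$ for all $n\ge2$. -/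

import Mathlib

namespace RotatingVortex

open Set

noncomputable section

/-- `g` belongs to the Hölder space `C^{2,β}([0,1])` (one-sided derivatives at the end points). -/
def IsC2Holder (β : NNReal) (g : ℝ → ℝ) : Prop :=
  ContDiffOn ℝ 2 g (Icc 0 1) ∧
    ∃ C : NNReal, HolderOnWith C β (iteratedDerivWithin 2 g (Icc 0 1)) (Icc 0 1)

/-- The standing assumptions on the radial profile `f₀ : [0,1] → ℝ` (a function on `ℝ` of which only
the values on `[0,1]` matter): `f₀(r) = g(r²)` with `g ∈ C^{2,β}([0,1])` for some `β ∈ (0,1)`, and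
`inf_{r ∈ (0,1]} f₀'(r) / r > 0`. -/
structure IsProfile (f₀ : ℝ → ℝ) : Prop where
  regular : ∃ (β : NNReal) (g : ℝ → ℝ), 0 < β ∧ β < 1 ∧ IsC2Holder β g ∧
    ∀ r ∈ Icc (0 : ℝ) 1, f₀ r = g (r ^ 2)
  increasing : ∃ c : ℝ, 0 < c ∧ ∀ r ∈ Ioc (0 : ℝ) 1, c ≤ derivWithin f₀ (Icc 0 1) r / r

/-- `κ₁ = inf_{r ∈ [0,1]} ∫₀¹ s f₀(rs) ds`. -/
def kappa₁ (f₀ : ℝ → ℝ) : ℝ := ⨅ r : Icc (0 : ℝ) 1, ∫ s in (0 : ℝ)..1, s * f₀ (r * s)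

/-- `κ₂ = sup_{r ∈ [0,1]} ∫₀¹ s f₀(rs) ds`. -/
def kappa₂ (f₀ : ℝ → ℝ) : ℝ := ⨆ r : Icc (0 : ℝ) 1, ∫ s in (0 : ℝ)..1, s * f₀ (r * s)

/-- `μ⁰_Ω(r) = f₀'(r) / (r (Ω - ∫₀¹ s f₀(sr) ds))` for `r ∈ (0,1]`. -/
def mu0 (f₀ : ℝ → ℝ) (Ω r : ℝ) : ℝ :=
  derivWithin f₀ (Icc 0 1) r / (r * (Ω - ∫ s in (0 : ℝ)..1, s * f₀ (s * r)))

/-- The sign `σ_Ω`: `-1` for `Ω < κ₁`, `1` for `Ω > κ₂` (and the placeholder `0` on `[κ₁, κ₂]`, which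
is outside its domain). -/
def sigma (f₀ : ℝ → ℝ) (Ω : ℝ) : ℝ :=
  if Ω < kappa₁ f₀ then -1 else if kappa₂ f₀ < Ω then 1 else 0

/-- The potential `ν_Ω = σ_Ω μ⁰_Ω`. -/
def nu (f₀ : ℝ → ℝ) (Ω r : ℝ) : ℝ := sigma f₀ Ω * mu0 f₀ Ω r

/-- `F` is a solution of class `C²` on `[0,1]` of the normalized Sturm–Liouville problem
`F'' + (2n+1)/r F' + σ_Ω ν_Ω(r) F = 0` on `(0,1)`, `F(0) = 1`. -/
def IsSturmLiouvilleSol (f₀ : ℝ → ℝ) (n : ℕ) (Ω : ℝ) (F : ℝ → ℝ) : Prop :=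
  ContDiffOn ℝ 2 F (Icc 0 1) ∧ F 0 = 1 ∧
    ∀ r ∈ Ioo (0 : ℝ) 1,
      iteratedDerivWithin 2 F (Icc 0 1) r
        + (2 * (n : ℝ) + 1) / r * derivWithin F (Icc 0 1) r
        + sigma f₀ Ω * nu f₀ Ω r * F r = 0

/-- The problem above has a solution, and any two solutions agree on `[0,1]`. -/
def HasUniqueSturmLiouvilleSol (f₀ : ℝ → ℝ) (n : ℕ) (Ω : ℝ) : Prop :=
  ∃ F, IsSturmLiouvilleSol f₀ n Ω F ∧
    ∀ G, IsSturmLiouvilleSol f₀ n Ω G → EqOn G F (Icc 0 1)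

/-- `F_{n,Ω}`: the `C²` solution on `[0,1]` of the normalized Sturm–Liouville problem. -/
def slSol (f₀ : ℝ → ℝ) (n : ℕ) (Ω : ℝ) : ℝ → ℝ :=
  Classical.epsilon (IsSturmLiouvilleSol f₀ n Ω)

/-- The dispersion function `ζ_n(Ω)`. -/
def zeta (f₀ : ℝ → ℝ) (n : ℕ) (Ω : ℝ) : ℝ :=
  slSol f₀ n Ω 1 * (Ω - (n : ℝ) / (n + 1) * ∫ s in (0 : ℝ)..1, s * f₀ s)
    + ∫ s in (0 : ℝ)..1, slSol f₀ n Ω s * s ^ (2 * n + 1) * (f₀ s - 2 * Ω)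

/-- `Ω̂_n = ∫₀¹ s f₀(s) ds - (n+1)/n ∫₀¹ s^{2n+1} f₀(s) ds`, for `n ≥ 1`. -/
def omegaHat (f₀ : ℝ → ℝ) (n : ℕ) : ℝ :=
  (∫ s in (0 : ℝ)..1, s * f₀ s)
    - ((n : ℝ) + 1) / n * ∫ s in (0 : ℝ)..1, s ^ (2 * n + 1) * f₀ s

end

end RotatingVortex

/-!
For `Ω > κ₂` the Sturm–Liouville problem is equivalent to the Volterra equation
`F = 1 - Δ⁻¹(M F)`, where `M = σ_Ω ν_Ω ≥ 0` is the potential and `Δ⁻¹` inverts the radial Laplacian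
in dimension `2n + 2`. Near `κ₂` the potential has size `1 / (Ω - κ₂ + 1 - r²)`, so `∫₀¹ s M(s) ds`
grows only like `log (1 / (Ω - κ₂))`, while `Δ⁻¹` gains a factor `1 / n`. For `Ω - κ₂` of order
`1 / m` and `n ≥ m` the equation is therefore a contraction, with solution close to `1`.

Splitting off the boundary value of the solution,
`ζ_n(Ω) = F(1) n / (n + 1) (Ω - Ω̂_n) + ∫₀¹ (F(s) - F(1)) s^(2n+1) (f₀(s) - 2Ω) ds`.
The remaining integral is `O(1 / m²)`. At `Ω = Ω̂_m` it is positive, because `F` is decreasing and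
`f₀(1) > 2κ₂` for an increasing profile; at distance `C / m²` below `Ω̂_m` the main term wins and
`ζ_m < 0`. Hence `ζ_m` has a zero in between. Since `Ω̂_n - κ₂ ∼ -f₀(1) / (2n)`, the numbers
`Ω̂_{nm}` with `n ≥ 2` lie below this zero by an amount of order `1 / m`, so that `ζ_{nm}` is
positive there.
-/

namespace RotatingVortex

open Set Filter Topology

noncomputable section

section RadialPrimitive

/-- The weighted average `∫₀¹ uᵈ h(ru) du`: up to the factor `d + 1`, the mean of the radial
function with profile `h` over the ball of radius `r` in dimension `d + 1`. -/
def radialAvg (d : ℕ) (h : ℝ → ℝ) (r : ℝ) : ℝ := ∫ u in (0 : ℝ)..1, u ^ d * h (r * u)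

/-- The solution of `W'' + (d/r) W' = h` that is regular at the origin and vanishes there, i.e. the
inverse of the radial Laplacian in dimension `d + 1` applied to `h`. -/
def radialPrimitive (d : ℕ) (h : ℝ → ℝ) (r : ℝ) : ℝ := ∫ t in (0 : ℝ)..r, t * radialAvg d h t

variable {d : ℕ} {h k : ℝ → ℝ} {r t : ℝ}

theorem exists_continuous_eqOn_Icc {a b : ℝ} (hab : a ≤ b) (hh : ContinuousOn h (Icc a b)) :
    ∃ k, Continuous k ∧ EqOn h k (Icc a b) :=
  ⟨IccExtend hab ((Icc a b).domRestrict h), hh.domRestrict.Icc_extend',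
    fun _ hx => (IccExtend_of_mem hab ((Icc a b).domRestrict h) hx).symm⟩

theorem intervalIntegrable_pow_mul_comp_mul (d : ℕ) (hh : ContinuousOn h (Icc 0 1))
    (hr : r ∈ Icc (0 : ℝ) 1) :
    IntervalIntegrable (fun u => u ^ d * h (r * u)) MeasureTheory.volume 0 1 := by
  refine ContinuousOn.intervalIntegrable_of_Icc zero_le_one ?_
  exact (continuousOn_pow d).mul
    (hh.comp (continuousOn_const.mul continuousOn_id) fun u hu => unitInterval.mul_mem hr hu)

theorem radialAvg_congr (d : ℕ) (e : EqOn h k (Icc 0 1)) :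
    EqOn (radialAvg d h) (radialAvg d k) (Icc 0 1) := fun r hr =>
  intervalIntegral.integral_congr fun u hu => by
    rw [uIcc_of_le zero_le_one] at hu
    simp only [e (unitInterval.mul_mem hr hu)]

theorem radialAvg_const (d : ℕ) (a r : ℝ) : radialAvg d (fun _ => a) r = a / (d + 1) := by
  simp [radialAvg, div_eq_inv_mul]

theorem radialAvg_zero_right (d : ℕ) (h : ℝ → ℝ) : radialAvg d h 0 = h 0 / (d + 1) := by
  simpa [radialAvg] using radialAvg_const d (h 0) 0

theorem radialAvg_smul (d : ℕ) (a : ℝ) (h : ℝ → ℝ) (r : ℝ) :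
    radialAvg d (a • h) r = a * radialAvg d h r := by
  simp only [radialAvg, ← intervalIntegral.integral_const_mul, Pi.smul_apply, smul_eq_mul,
    mul_left_comm]

theorem radialAvg_sub (d : ℕ) (hh : ContinuousOn h (Icc 0 1)) (hk : ContinuousOn k (Icc 0 1))
    (hr : r ∈ Icc (0 : ℝ) 1) :
    radialAvg d (h - k) r = radialAvg d h r - radialAvg d k r := by
  simp only [radialAvg, Pi.sub_apply, mul_sub]
  exact intervalIntegral.integral_sub (intervalIntegrable_pow_mul_comp_mul d hh hr)
    (intervalIntegrable_pow_mul_comp_mul d hk hr)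

theorem radialAvg_mono (d : ℕ) (hh : ContinuousOn h (Icc 0 1)) (hk : ContinuousOn k (Icc 0 1))
    (hle : ∀ x ∈ Icc (0 : ℝ) 1, h x ≤ k x) (hr : r ∈ Icc (0 : ℝ) 1) :
    radialAvg d h r ≤ radialAvg d k r :=
  intervalIntegral.integral_mono_on zero_le_one (intervalIntegrable_pow_mul_comp_mul d hh hr)
    (intervalIntegrable_pow_mul_comp_mul d hk hr) fun _ hu =>
      mul_le_mul_of_nonneg_left (hle _ (unitInterval.mul_mem hr hu)) (pow_nonneg hu.1 d)

theorem pow_succ_mul_radialAvg (d : ℕ) (h : ℝ → ℝ) (r : ℝ) :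
    r ^ (d + 1) * radialAvg d h r = ∫ s in (0 : ℝ)..r, s ^ d * h s := by
  have hsubst := intervalIntegral.mul_integral_comp_mul_left (a := 0) (b := 1)
    (f := fun s => s ^ d * h s) (c := r)
  rw [mul_zero, mul_one] at hsubst
  rw [← hsubst, radialAvg, pow_succ', mul_assoc, ← intervalIntegral.integral_const_mul]
  simp only [mul_pow, mul_assoc]

theorem continuous_radialAvg (d : ℕ) (hh : Continuous h) : Continuous (radialAvg d h) := by
  unfold radialAvg
  exact intervalIntegral.continuous_parametric_intervalIntegral_of_continuous' (by fun_prop) 0 1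

theorem continuousOn_radialAvg (d : ℕ) (hh : ContinuousOn h (Icc 0 1)) :
    ContinuousOn (radialAvg d h) (Icc 0 1) := by
  obtain ⟨k, hk, e⟩ := exists_continuous_eqOn_Icc zero_le_one hh
  exact (continuous_radialAvg d hk).continuousOn.congr (radialAvg_congr d e)

theorem continuousOn_id_mul_radialAvg (d : ℕ) (hh : ContinuousOn h (Icc 0 1)) :
    ContinuousOn (fun t => t * radialAvg d h t) (Icc 0 1) :=
  continuousOn_id.mul (continuousOn_radialAvg d hh)

theorem intervalIntegrable_id_mul_radialAvg (d : ℕ) (hh : ContinuousOn h (Icc 0 1))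
    (hr : r ∈ Icc (0 : ℝ) 1) (ht : t ∈ Icc (0 : ℝ) 1) :
    IntervalIntegrable (fun t => t * radialAvg d h t) MeasureTheory.volume r t :=
  ((continuousOn_id_mul_radialAvg d hh).mono (uIcc_subset_Icc hr ht)).intervalIntegrable

theorem radialPrimitive_zero_right (d : ℕ) (h : ℝ → ℝ) : radialPrimitive d h 0 = 0 :=
  intervalIntegral.integral_same

theorem radialPrimitive_const (d : ℕ) (a r : ℝ) :
    radialPrimitive d (fun _ => a) r = a / (2 * (d + 1)) * r ^ 2 := by
  simp only [radialPrimitive, radialAvg_const, intervalIntegral.integral_mul_const, integral_id]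
  field_simp
  ring

theorem radialPrimitive_zero_left (d : ℕ) (r : ℝ) : radialPrimitive d 0 r = 0 :=
  (radialPrimitive_const d 0 r).trans (by simp)

theorem radialPrimitive_smul (d : ℕ) (a : ℝ) (h : ℝ → ℝ) (r : ℝ) :
    radialPrimitive d (a • h) r = a * radialPrimitive d h r := by
  simp only [radialPrimitive, radialAvg_smul, ← intervalIntegral.integral_const_mul,
    mul_left_comm]

theorem radialPrimitive_sub (d : ℕ) (hh : ContinuousOn h (Icc 0 1))
    (hk : ContinuousOn k (Icc 0 1)) (hr : r ∈ Icc (0 : ℝ) 1) :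
    radialPrimitive d (h - k) r = radialPrimitive d h r - radialPrimitive d k r := by
  have h0 : (0 : ℝ) ∈ Icc (0 : ℝ) 1 := left_mem_Icc.2 zero_le_one
  simp only [radialPrimitive]
  rw [← intervalIntegral.integral_sub (intervalIntegrable_id_mul_radialAvg d hh h0 hr)
    (intervalIntegrable_id_mul_radialAvg d hk h0 hr)]
  refine intervalIntegral.integral_congr fun t ht => ?_
  simp only [radialAvg_sub d hh hk (uIcc_subset_Icc h0 hr ht), mul_sub]

theorem radialPrimitive_sub_le_sub (d : ℕ) (hh : ContinuousOn h (Icc 0 1))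
    (hk : ContinuousOn k (Icc 0 1)) (hle : ∀ x ∈ Icc (0 : ℝ) 1, h x ≤ k x)
    (hr : r ∈ Icc (0 : ℝ) 1) (ht : t ∈ Icc (0 : ℝ) 1) (hrt : r ≤ t) :
    radialPrimitive d h t - radialPrimitive d h r
      ≤ radialPrimitive d k t - radialPrimitive d k r := by
  have h0 : (0 : ℝ) ∈ Icc (0 : ℝ) 1 := left_mem_Icc.2 zero_le_one
  simp only [radialPrimitive]
  rw [intervalIntegral.integral_interval_sub_left (intervalIntegrable_id_mul_radialAvg d hh h0 ht)
      (intervalIntegrable_id_mul_radialAvg d hh h0 hr),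
    intervalIntegral.integral_interval_sub_left (intervalIntegrable_id_mul_radialAvg d hk h0 ht)
      (intervalIntegrable_id_mul_radialAvg d hk h0 hr)]
  refine intervalIntegral.integral_mono_on hrt (intervalIntegrable_id_mul_radialAvg d hh hr ht)
    (intervalIntegrable_id_mul_radialAvg d hk hr ht) fun u hu => ?_
  have hu' := Icc_subset_Icc hr.1 ht.2 hu
  exact mul_le_mul_of_nonneg_left (radialAvg_mono d hh hk hle hu') hu'.1

theorem radialPrimitive_mono (d : ℕ) (hh : ContinuousOn h (Icc 0 1))
    (hk : ContinuousOn k (Icc 0 1)) (hle : ∀ x ∈ Icc (0 : ℝ) 1, h x ≤ k x)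
    (hr : r ∈ Icc (0 : ℝ) 1) : radialPrimitive d h r ≤ radialPrimitive d k r := by
  simpa [radialPrimitive_zero_right] using
    radialPrimitive_sub_le_sub d hh hk hle (left_mem_Icc.2 zero_le_one) hr hr.1

theorem monotoneOn_radialPrimitive (d : ℕ) (hh : ContinuousOn h (Icc 0 1))
    (hpos : ∀ x ∈ Icc (0 : ℝ) 1, 0 ≤ h x) : MonotoneOn (radialPrimitive d h) (Icc 0 1) :=
  fun r hr t ht hrt => by
    simpa [radialPrimitive_const] using
      radialPrimitive_sub_le_sub d continuousOn_const hh hpos hr ht hrt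

theorem radialPrimitive_nonneg (d : ℕ) (hh : ContinuousOn h (Icc 0 1))
    (hpos : ∀ x ∈ Icc (0 : ℝ) 1, 0 ≤ h x) (hr : r ∈ Icc (0 : ℝ) 1) :
    0 ≤ radialPrimitive d h r := by
  simpa [radialPrimitive_const] using radialPrimitive_mono d continuousOn_const hh hpos hr

theorem abs_radialPrimitive_mul_le (d : ℕ) {M F : ℝ → ℝ} {B : ℝ}
    (hM : ContinuousOn M (Icc 0 1)) (hF : ContinuousOn F (Icc 0 1))
    (hM0 : ∀ x ∈ Icc (0 : ℝ) 1, 0 ≤ M x) (hB : ∀ x ∈ Icc (0 : ℝ) 1, |F x| ≤ B)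
    (hr : r ∈ Icc (0 : ℝ) 1) :
    |radialPrimitive d (M * F) r| ≤ B * radialPrimitive d M 1 := by
  have hB0 : 0 ≤ B := (abs_nonneg _).trans (hB r hr)
  have upper : radialPrimitive d (M * F) r ≤ radialPrimitive d (B • M) r :=
    radialPrimitive_mono d (hM.mul hF) (hM.const_smul B) (fun x hx => by
      simpa [mul_comm] using mul_le_mul_of_nonneg_left (abs_le.1 (hB x hx)).2 (hM0 x hx)) hr
  have lower : radialPrimitive d (-B • M) r ≤ radialPrimitive d (M * F) r :=
    radialPrimitive_mono d (hM.const_smul (-B)) (hM.mul hF) (fun x hx => by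
      simpa [mul_comm] using mul_le_mul_of_nonneg_left (abs_le.1 (hB x hx)).1 (hM0 x hx)) hr
  rw [radialPrimitive_smul] at upper lower
  have := mul_le_mul_of_nonneg_left (monotoneOn_radialPrimitive d hM hM0 hr
    (right_mem_Icc.2 zero_le_one) hr.2) hB0
  exact abs_le.2 ⟨by linarith, upper.trans this⟩

theorem hasDerivWithinAt_integral_Icc {a b : ℝ} (hh : ContinuousOn h (Icc a b))
    (hr : r ∈ Icc a b) : HasDerivWithinAt (fun x => ∫ s in a..x, h s) (h r) (Icc a b) r := by
  have : Fact (r ∈ Icc a b) := ⟨hr⟩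
  have hsub : uIcc a r ⊆ Icc a b := uIcc_subset_Icc (left_mem_Icc.2 (hr.1.trans hr.2)) hr
  exact intervalIntegral.integral_hasDerivWithinAt_right (hh.mono hsub).intervalIntegrable
    (hh.stronglyMeasurableAtFilter_nhdsWithin measurableSet_Icc r) (hh r hr)

theorem hasDerivWithinAt_radialPrimitive (d : ℕ) (hh : ContinuousOn h (Icc 0 1))
    (hr : r ∈ Icc (0 : ℝ) 1) :
    HasDerivWithinAt (radialPrimitive d h) (r * radialAvg d h r) (Icc 0 1) r :=
  hasDerivWithinAt_integral_Icc (continuousOn_id_mul_radialAvg d hh) hr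

theorem continuousOn_radialPrimitive (d : ℕ) (hh : ContinuousOn h (Icc 0 1)) :
    ContinuousOn (radialPrimitive d h) (Icc 0 1) := fun _ hr =>
  (hasDerivWithinAt_radialPrimitive d hh hr).continuousWithinAt

theorem hasDerivWithinAt_id_mul_radialAvg (d : ℕ) (hh : ContinuousOn h (Icc 0 1))
    (hr : r ∈ Icc (0 : ℝ) 1) :
    HasDerivWithinAt (fun r => r * radialAvg d h r) (h r - d * radialAvg d h r) (Icc 0 1) r := by
  rcases hr.1.eq_or_lt with rfl | hr0
  · have hval : h 0 - d * radialAvg d h 0 = radialAvg d h 0 := by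
      rw [radialAvg_zero_right]
      field_simp
      ring
    rw [hval, hasDerivWithinAt_iff_tendsto_slope]
    refine ((continuousOn_radialAvg d hh 0 hr).mono sdiff_subset).tendsto.congr' ?_
    filter_upwards [self_mem_nhdsWithin] with x hx
    simp [slope_def_field, show x ≠ 0 from hx.2]
  · have hquot := (hasDerivWithinAt_integral_Icc ((continuousOn_pow d).mul hh) hr).div
      (hasDerivWithinAt_pow d r) (pow_ne_zero d hr0.ne')
    have hpow : (d : ℝ) * r ^ (d - 1) = d * r ^ d / r := by
      cases d with
      | zero => simp
      | succ d => field_simp; simp [pow_succ]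
    refine (hquot.congr_of_eventuallyEq_of_mem ?_ hr).congr_deriv ?_
    · filter_upwards [mem_nhdsWithin_of_mem_nhds (Ioi_mem_nhds hr0)] with x hx
      have hx0 : x ≠ 0 := (mem_Ioi.1 hx).ne'
      simp only [Pi.div_apply, Pi.mul_apply, ← pow_succ_mul_radialAvg]
      field_simp
      ring
    · simp only [Pi.mul_apply, ← pow_succ_mul_radialAvg, hpow]
      field_simp
      ring

theorem contDiffOn_radialPrimitive (d : ℕ) (hh : ContinuousOn h (Icc 0 1)) :
    ContDiffOn ℝ 2 (radialPrimitive d h) (Icc 0 1) := by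
  have hu := uniqueDiffOn_Icc (zero_lt_one (α := ℝ))
  have d₁ : EqOn (derivWithin (radialPrimitive d h) (Icc 0 1)) (fun r => r * radialAvg d h r)
      (Icc 0 1) := fun r hr => (hasDerivWithinAt_radialPrimitive d hh hr).derivWithin (hu r hr)
  have d₂ : EqOn (derivWithin (fun r => r * radialAvg d h r) (Icc 0 1))
      (fun r => h r - d * radialAvg d h r) (Icc 0 1) := fun r hr =>
    (hasDerivWithinAt_id_mul_radialAvg d hh hr).derivWithin (hu r hr)
  rw [← one_add_one_eq_two, contDiffOn_succ_iff_derivWithin hu, contDiffOn_congr d₁,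
    contDiffOn_one_iff_derivWithin hu, continuousOn_congr d₂]
  exact ⟨fun r hr => (hasDerivWithinAt_radialPrimitive d hh hr).differentiableWithinAt, by simp,
    fun r hr => (hasDerivWithinAt_id_mul_radialAvg d hh hr).differentiableWithinAt,
    hh.sub (continuousOn_const.mul (continuousOn_radialAvg d hh))⟩

theorem radialAvg_one_add_radialPrimitive_one (d : ℕ) (hh : ContinuousOn h (Icc 0 1)) :
    radialAvg d h 1 + ((d : ℝ) - 1) * radialPrimitive d h 1 = ∫ s in (0 : ℝ)..1, s * h s := by
  have hderiv : ∀ r ∈ Ioo (0 : ℝ) 1, HasDerivAt (fun r => r * (r * radialAvg d h r))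
      (r * h r - ((d : ℝ) - 1) * (r * radialAvg d h r)) r := fun r hr => by
    refine ((hasDerivAt_id r).mul ((hasDerivWithinAt_id_mul_radialAvg d hh
      (Ioo_subset_Icc_self hr)).hasDerivAt (Icc_mem_nhds hr.1 hr.2))).congr_deriv ?_
    simp only [id]
    ring
  have hint : IntervalIntegrable (fun r => r * h r) MeasureTheory.volume 0 1 :=
    (continuousOn_id.mul hh).intervalIntegrable_of_Icc zero_le_one
  have hint' := (intervalIntegrable_id_mul_radialAvg d hh (left_mem_Icc.2 zero_le_one)
    (right_mem_Icc.2 zero_le_one)).const_mul ((d : ℝ) - 1)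
  have hftc := intervalIntegral.integral_eq_sub_of_hasDerivAt_of_le zero_le_one
    (continuousOn_id.mul (continuousOn_id_mul_radialAvg d hh)) hderiv (hint.sub hint')
  rw [intervalIntegral.integral_sub hint hint', intervalIntegral.integral_const_mul] at hftc
  simp only [Pi.mul_apply, id] at hftc
  rw [radialPrimitive]
  linarith

theorem sub_one_mul_radialPrimitive_one_le (d : ℕ) (hh : ContinuousOn h (Icc 0 1))
    (hpos : ∀ x ∈ Icc (0 : ℝ) 1, 0 ≤ h x) :
    ((d : ℝ) - 1) * radialPrimitive d h 1 ≤ ∫ s in (0 : ℝ)..1, s * h s := by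
  have havg := radialAvg_mono d continuousOn_const hh hpos (right_mem_Icc.2 zero_le_one)
  rw [radialAvg_const, zero_div] at havg
  rw [← radialAvg_one_add_radialPrimitive_one d hh]
  exact le_add_of_nonneg_left havg

theorem monotoneOn_radialAvg (d : ℕ) (hh : ContinuousOn h (Icc 0 1))
    (hmono : MonotoneOn h (Icc 0 1)) : MonotoneOn (radialAvg d h) (Icc 0 1) :=
  fun _ hr _ ht hrt =>
    intervalIntegral.integral_mono_on zero_le_one (intervalIntegrable_pow_mul_comp_mul d hh hr)
      (intervalIntegrable_pow_mul_comp_mul d hh ht) fun _ hu =>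
        mul_le_mul_of_nonneg_left (hmono (unitInterval.mul_mem hr hu) (unitInterval.mul_mem ht hu)
          (mul_le_mul_of_nonneg_right hrt hu.1)) (pow_nonneg hu.1 d)

theorem radialAvg_sq (d : ℕ) (a r : ℝ) :
    radialAvg d (fun x => a * x ^ 2) r = a / (d + 3) * r ^ 2 := by
  have hring : ∀ u : ℝ, u ^ d * (a * (r * u) ^ 2) = a * r ^ 2 * u ^ (d + 2) := fun u => by ring
  simp only [radialAvg, hring, intervalIntegral.integral_const_mul, integral_pow]
  rw [one_pow, zero_pow (Nat.succ_ne_zero _), sub_zero]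
  push_cast
  field_simp
  ring

theorem mul_one_sub_sq_le_radialAvg_sub {a : ℝ} (d : ℕ) (hh : ContinuousOn h (Icc 0 1))
    (hmono : MonotoneOn (fun x => h x - a * x ^ 2) (Icc 0 1)) (hr : r ∈ Icc (0 : ℝ) 1) :
    a / (d + 3) * (1 - r ^ 2) ≤ radialAvg d h 1 - radialAvg d h r := by
  have hsq : ContinuousOn (fun x : ℝ => a * x ^ 2) (Icc 0 1) := by fun_prop
  have h1 := right_mem_Icc.2 (zero_le_one (α := ℝ))
  have := monotoneOn_radialAvg d (hh.sub hsq) hmono hr h1 hr.2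
  rw [radialAvg_sub d hh hsq hr, radialAvg_sub d hh hsq h1, radialAvg_sq, radialAvg_sq] at this
  linarith

theorem mul_sub_le_sub_radialAvg_one {a : ℝ} (d : ℕ) (hh : ContinuousOn h (Icc 0 1))
    (hmono : MonotoneOn (fun x => h x - a * x ^ 2) (Icc 0 1)) :
    a / (d + 1) - a / (d + 3) ≤ h 1 / (d + 1) - radialAvg d h 1 := by
  have hsq : ContinuousOn (fun x : ℝ => a * x ^ 2) (Icc 0 1) := by fun_prop
  have h1 := right_mem_Icc.2 (zero_le_one (α := ℝ))
  have := radialAvg_mono d (hh.sub hsq) (continuousOn_const (c := h 1 - a * 1 ^ 2))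
    (fun x hx => hmono hx h1 hx.2) h1
  rw [radialAvg_sub d hh hsq h1, radialAvg_const, radialAvg_sq, sub_div, one_pow, mul_one,
    mul_one] at this
  linarith

/-- The radial Laplacian `F'' + (d/r) F'` in dimension `d + 1`, of a function on `[0,1]`. -/
def radialLaplacian (d : ℕ) (F : ℝ → ℝ) (r : ℝ) : ℝ :=
  iteratedDerivWithin 2 F (Icc 0 1) r + d / r * derivWithin F (Icc 0 1) r

theorem radialLaplacian_const_sub_radialPrimitive (a : ℝ) (hh : ContinuousOn h (Icc 0 1))
    (hr : r ∈ Ioo (0 : ℝ) 1) :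
    radialLaplacian d (fun r => a - radialPrimitive d h r) r = -h r := by
  have hu := uniqueDiffOn_Icc (zero_lt_one (α := ℝ))
  have hr' := Ioo_subset_Icc_self hr
  have d₁ : EqOn (derivWithin (fun r => a - radialPrimitive d h r) (Icc 0 1))
      (fun r => -(r * radialAvg d h r)) (Icc 0 1) := fun x hx =>
    ((hasDerivWithinAt_radialPrimitive d hh hx).const_sub a).derivWithin (hu x hx)
  rw [radialLaplacian, iteratedDerivWithin_succ, iteratedDerivWithin_one, d₁ hr',
    derivWithin_congr d₁ (d₁ hr'),
    (hasDerivWithinAt_id_mul_radialAvg d hh hr').fun_neg.derivWithin (hu r hr')]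
  have hr0 : r ≠ 0 := hr.1.ne'
  field_simp
  ring

theorem derivWithin_eq_of_radialLaplacian_eq (hd : d ≠ 0) {F : ℝ → ℝ}
    (hF : ContDiffOn ℝ 2 F (Icc 0 1)) (hh : ContinuousOn h (Icc 0 1))
    (hLap : ∀ r ∈ Ioo (0 : ℝ) 1, radialLaplacian d F r = h r) (hr : r ∈ Ioo (0 : ℝ) 1) :
    derivWithin F (Icc 0 1) r = r * radialAvg d h r := by
  have hu := uniqueDiffOn_Icc (zero_lt_one (α := ℝ))
  have hF' : ContDiffOn ℝ 1 (derivWithin F (Icc 0 1)) (Icc 0 1) :=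
    hF.derivWithin hu (by norm_num)
  have hsub : Icc 0 r ⊆ Icc (0 : ℝ) 1 := Icc_subset_Icc_right hr.2.le
  have hderiv : ∀ x ∈ Ioo 0 r, HasDerivAt (fun x => x ^ d * derivWithin F (Icc 0 1) x)
      (x ^ d * h x) x := fun x hx => by
    have hx' : x ∈ Ioo (0 : ℝ) 1 := Ioo_subset_Ioo_right hr.2.le hx
    have hF'' := ((hF'.differentiableOn one_ne_zero) x (Ioo_subset_Icc_self hx')).hasDerivWithinAt
      |>.hasDerivAt (Icc_mem_nhds hx'.1 hx'.2)
    refine ((hasDerivAt_pow d x).mul hF'').congr_deriv ?_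
    rw [← hLap x hx', radialLaplacian, iteratedDerivWithin_succ, iteratedDerivWithin_one]
    obtain ⟨d, rfl⟩ := Nat.exists_eq_succ_of_ne_zero hd
    have hx0 : x ≠ 0 := hx.1.ne'
    simp only [Nat.succ_eq_add_one, Nat.add_sub_cancel]
    field_simp
    ring
  have hftc := intervalIntegral.integral_eq_sub_of_hasDerivAt_of_le hr.1.le
    ((continuousOn_pow d).mul (hF'.continuousOn.mono hsub)) hderiv
    (((continuousOn_pow d).mul (hh.mono hsub)).intervalIntegrable_of_Icc hr.1.le)
  rw [← pow_succ_mul_radialAvg] at hftc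
  simp only [Pi.mul_apply, zero_pow hd, zero_mul, sub_zero, pow_succ, mul_assoc] at hftc
  exact (mul_left_cancel₀ (pow_ne_zero d hr.1.ne') hftc).symm

theorem eq_add_radialPrimitive_of_radialLaplacian_eq (hd : d ≠ 0) {F : ℝ → ℝ}
    (hF : ContDiffOn ℝ 2 F (Icc 0 1)) (hh : ContinuousOn h (Icc 0 1))
    (hLap : ∀ r ∈ Ioo (0 : ℝ) 1, radialLaplacian d F r = h r) (hr : r ∈ Icc (0 : ℝ) 1) :
    F r = F 0 + radialPrimitive d h r := by
  have hsub : Icc 0 r ⊆ Icc (0 : ℝ) 1 := Icc_subset_Icc_right hr.2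
  have hftc := intervalIntegral.integral_eq_sub_of_hasDerivAt_of_le hr.1
    (hF.continuousOn.mono hsub) (fun x hx => ?_)
    (intervalIntegrable_id_mul_radialAvg d hh (left_mem_Icc.2 zero_le_one) hr)
  · rw [radialPrimitive, hftc, add_sub_cancel]
  · have hx' := Ioo_subset_Ioo_right hr.2 hx
    rw [← derivWithin_eq_of_radialLaplacian_eq hd hF hh hLap hx']
    exact ((hF.differentiableOn two_ne_zero) x (Ioo_subset_Icc_self hx')).hasDerivWithinAt
      |>.hasDerivAt (Icc_mem_nhds hx'.1 hx'.2)

end RadialPrimitive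

section Volterra

/-- `F` solves `F'' + (d/r) F' + M F = 0`, `F(0) = 1` on `[0,1]`, in the integrated form
`F = 1 - Δ⁻¹(M F)`, where `Δ⁻¹` is `radialPrimitive d`. -/
structure IsVolterraSol (d : ℕ) (M F : ℝ → ℝ) : Prop where
  continuousOn : ContinuousOn F (Icc 0 1)
  eq : ∀ r ∈ Icc (0 : ℝ) 1, F r = 1 - radialPrimitive d (M * F) r

variable {d : ℕ} {M M₁ M₂ F F₁ F₂ : ℝ → ℝ} {r : ℝ}

theorem isVolterraSol_zero_one (d : ℕ) : IsVolterraSol d 0 1 where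
  continuousOn := continuousOn_const
  eq r _ := by rw [zero_mul, radialPrimitive_zero_left, sub_zero, Pi.one_apply]

theorem IsVolterraSol.abs_sub_le {D : ℝ} (h₁ : IsVolterraSol d M₁ F₁)
    (h₂ : IsVolterraSol d M₂ F₂) (hM₁ : ContinuousOn M₁ (Icc 0 1))
    (hM₂ : ContinuousOn M₂ (Icc 0 1)) (hM₁0 : ∀ x ∈ Icc (0 : ℝ) 1, 0 ≤ M₁ x)
    (hlt : radialPrimitive d M₁ 1 < 1)
    (hD : ∀ x ∈ Icc (0 : ℝ) 1, |radialPrimitive d ((M₁ - M₂) * F₂) x| ≤ D)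
    (hr : r ∈ Icc (0 : ℝ) 1) : |F₁ r - F₂ r| ≤ D / (1 - radialPrimitive d M₁ 1) := by
  have hF := h₁.continuousOn.sub h₂.continuousOn
  obtain ⟨x, hx, hmax⟩ := isCompact_Icc.exists_isMaxOn (nonempty_Icc.2 zero_le_one) hF.abs
  have hself := abs_radialPrimitive_mul_le d hM₁ hF hM₁0 hmax hx
  have hdiff : F₂ x - F₁ x = radialPrimitive d (M₁ * (F₁ - F₂)) x
      + radialPrimitive d ((M₁ - M₂) * F₂) x := by
    rw [mul_sub, sub_mul,
      radialPrimitive_sub d (hM₁.mul h₁.continuousOn) (hM₁.mul h₂.continuousOn) hx,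
      radialPrimitive_sub d (hM₁.mul h₂.continuousOn) (hM₂.mul h₂.continuousOn) hx,
      h₁.eq x hx, h₂.eq x hx]
    ring
  have hbound : |(F₁ - F₂) x| ≤ |(F₁ - F₂) x| * radialPrimitive d M₁ 1 + D := by
    conv_lhs => rw [Pi.sub_apply, abs_sub_comm, hdiff]
    exact (abs_add_le _ _).trans (add_le_add hself (hD x hx))
  refine (hmax hr).trans ((le_div_iff₀ (sub_pos.2 hlt)).2 ?_)
  linarith

theorem IsVolterraSol.eqOn (h₁ : IsVolterraSol d M F₁) (h₂ : IsVolterraSol d M F₂)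
    (hM : ContinuousOn M (Icc 0 1)) (hM0 : ∀ x ∈ Icc (0 : ℝ) 1, 0 ≤ M x)
    (hlt : radialPrimitive d M 1 < 1) : EqOn F₁ F₂ (Icc 0 1) := fun r hr => by
  have := h₁.abs_sub_le h₂ hM hM hM0 hlt (D := 0) (fun x _ => by
    rw [sub_self, zero_mul, radialPrimitive_zero_left, abs_zero]) hr
  rw [zero_div] at this
  exact sub_eq_zero.1 (abs_nonpos_iff.1 this)

theorem IsVolterraSol.abs_sub_one_le (h : IsVolterraSol d M F) (hM : ContinuousOn M (Icc 0 1))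
    (hM0 : ∀ x ∈ Icc (0 : ℝ) 1, 0 ≤ M x) (hlt : radialPrimitive d M 1 < 1)
    (hr : r ∈ Icc (0 : ℝ) 1) :
    |F r - 1| ≤ radialPrimitive d M 1 / (1 - radialPrimitive d M 1) :=
  h.abs_sub_le (isVolterraSol_zero_one d) hM continuousOn_const hM0 hlt (fun x hx => by
    simpa using abs_radialPrimitive_mul_le d (F := 1) (B := 1) hM continuousOn_const hM0
      (by simp) hx) hr

theorem IsVolterraSol.abs_sub_le_of_abs_sub_le {δ B : ℝ} (h₁ : IsVolterraSol d M₁ F₁)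
    (h₂ : IsVolterraSol d M₂ F₂) (hM₁ : ContinuousOn M₁ (Icc 0 1))
    (hM₂ : ContinuousOn M₂ (Icc 0 1)) (hM₁0 : ∀ x ∈ Icc (0 : ℝ) 1, 0 ≤ M₁ x)
    (hlt : radialPrimitive d M₁ 1 < 1) (hδ : ∀ x ∈ Icc (0 : ℝ) 1, |M₁ x - M₂ x| ≤ δ)
    (hB : ∀ x ∈ Icc (0 : ℝ) 1, |F₂ x| ≤ B) (hr : r ∈ Icc (0 : ℝ) 1) :
    |F₁ r - F₂ r| ≤ δ * B / (1 - radialPrimitive d M₁ 1) := by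
  have hδ0 : 0 ≤ δ := (abs_nonneg _).trans (hδ r hr)
  have hB0 : 0 ≤ B := (abs_nonneg _).trans (hB r hr)
  refine h₁.abs_sub_le h₂ hM₁ hM₂ hM₁0 hlt (fun x hx => ?_) hr
  have hsource : ∀ y ∈ Icc (0 : ℝ) 1, |((M₁ - M₂) * F₂) y| ≤ δ * B := fun y hy => by
    rw [Pi.mul_apply, abs_mul]
    exact mul_le_mul (hδ y hy) (hB y hy) (abs_nonneg _) hδ0
  have hone : radialPrimitive d (fun _ => 1) 1 ≤ 1 := by
    rw [radialPrimitive_const, one_pow, mul_one, div_le_one (by positivity)]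
    linarith [d.cast_nonneg (α := ℝ)]
  calc |radialPrimitive d ((M₁ - M₂) * F₂) x|
      = |radialPrimitive d ((fun _ => 1) * ((M₁ - M₂) * F₂)) x| := by
        rw [show (fun _ => 1 : ℝ → ℝ) = 1 from rfl, one_mul]
    _ ≤ δ * B * radialPrimitive d (fun _ => 1) 1 := abs_radialPrimitive_mul_le d
        continuousOn_const ((hM₁.sub hM₂).mul h₂.continuousOn) (fun _ _ => zero_le_one) hsource hx
    _ ≤ δ * B := mul_le_of_le_one_right (by positivity) hone

theorem exists_isVolterraSol (hM : ContinuousOn M (Icc 0 1))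
    (hM0 : ∀ x ∈ Icc (0 : ℝ) 1, 0 ≤ M x) (hlt : radialPrimitive d M 1 < 1) :
    ∃ F, IsVolterraSol d M F := by
  let ext : C(Icc (0 : ℝ) 1, ℝ) → ℝ → ℝ := fun F => IccExtend zero_le_one F
  have hext : ∀ F, ContinuousOn (ext F) (Icc 0 1) := fun F =>
    F.continuous.Icc_extend'.continuousOn
  let Φ : C(Icc (0 : ℝ) 1, ℝ) → C(Icc (0 : ℝ) 1, ℝ) := fun F =>
    ⟨(Icc 0 1).domRestrict fun r => 1 - radialPrimitive d (M * ext F) r,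
      (continuousOn_const.sub (continuousOn_radialPrimitive d (hM.mul (hext F)))).domRestrict⟩
  have hp : 0 ≤ radialPrimitive d M 1 :=
    radialPrimitive_nonneg d hM hM0 (right_mem_Icc.2 zero_le_one)
  have hΦ : ContractingWith (radialPrimitive d M 1).toNNReal Φ := by
    refine ⟨Real.toNNReal_lt_one.2 hlt, LipschitzWith.of_dist_le_mul fun F G => ?_⟩
    refine (ContinuousMap.dist_le (by positivity)).2 fun r => ?_
    have hdist : ∀ x ∈ Icc (0 : ℝ) 1, |(ext G - ext F) x| ≤ dist F G := fun x _ => by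
      rw [Pi.sub_apply, ← Real.dist_eq, dist_comm]
      exact ContinuousMap.dist_apply_le_dist _
    have hsub := radialPrimitive_sub d (hM.mul (hext G)) (hM.mul (hext F)) r.2
    have hle := abs_radialPrimitive_mul_le d hM ((hext G).sub (hext F)) hM0 hdist r.2
    rw [mul_sub, hsub] at hle
    change |1 - radialPrimitive d (M * ext F) r - (1 - radialPrimitive d (M * ext G) r)| ≤ _
    rwa [sub_sub_sub_cancel_left, Real.coe_toNNReal _ hp, mul_comm (radialPrimitive d M 1)]
  refine ⟨ext hΦ.fixedPoint, hext _, fun r hr => ?_⟩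
  calc ext hΦ.fixedPoint r = Φ hΦ.fixedPoint ⟨r, hr⟩ := by
        rw [hΦ.fixedPoint_isFixedPt]
        exact IccExtend_of_mem _ _ hr
    _ = 1 - radialPrimitive d (M * ext hΦ.fixedPoint) r := rfl

theorem isSturmLiouvilleSol_iff_isVolterraSol {f₀ : ℝ → ℝ} {n : ℕ} {Ω : ℝ}
    (hM : ContinuousOn M (Icc 0 1))
    (hν : ∀ r ∈ Ioo (0 : ℝ) 1, sigma f₀ Ω * nu f₀ Ω r = M r) :
    IsSturmLiouvilleSol f₀ n Ω F ↔ IsVolterraSol (2 * n + 1) M F := by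
  have hode : ∀ r ∈ Ioo (0 : ℝ) 1, iteratedDerivWithin 2 F (Icc 0 1) r
      + (2 * (n : ℝ) + 1) / r * derivWithin F (Icc 0 1) r + sigma f₀ Ω * nu f₀ Ω r * F r
      = radialLaplacian (2 * n + 1) F r + (M * F) r := fun r hr => by
    rw [radialLaplacian, hν r hr, Pi.mul_apply]
    push_cast
    rfl
  constructor
  · rintro ⟨hF, hF0, hsol⟩
    have hMF := hM.mul hF.continuousOn
    refine ⟨hF.continuousOn, fun r hr => ?_⟩
    rw [eq_add_radialPrimitive_of_radialLaplacian_eq (2 * n).succ_ne_zero hF hMF.neg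
      (fun r hr => eq_neg_of_add_eq_zero_left ((hode r hr).symm.trans (hsol r hr))) hr, hF0,
      ← neg_one_smul ℝ (M * F), radialPrimitive_smul, neg_one_mul, sub_eq_add_neg]
  · intro h
    have hMF := hM.mul h.continuousOn
    have heq : EqOn F (fun r => 1 - radialPrimitive (2 * n + 1) (M * F) r) (Icc 0 1) := h.eq
    refine ⟨(contDiffOn_const.sub (contDiffOn_radialPrimitive _ hMF)).congr heq, ?_,
      fun r hr => ?_⟩
    · rw [h.eq 0 (left_mem_Icc.2 zero_le_one), radialPrimitive_zero_right, sub_zero]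
    · have hr' := Ioo_subset_Icc_self hr
      rw [hode r hr, radialLaplacian, iteratedDerivWithin_congr heq hr',
        derivWithin_congr heq (heq hr'), ← radialLaplacian,
        radialLaplacian_const_sub_radialPrimitive 1 hMF hr, neg_add_cancel]

theorem hasUniqueSturmLiouvilleSol_of_radialPrimitive_lt {f₀ : ℝ → ℝ} {n : ℕ} {Ω : ℝ}
    (hM : ContinuousOn M (Icc 0 1)) (hM0 : ∀ x ∈ Icc (0 : ℝ) 1, 0 ≤ M x)
    (hν : ∀ r ∈ Ioo (0 : ℝ) 1, sigma f₀ Ω * nu f₀ Ω r = M r)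
    (hlt : radialPrimitive (2 * n + 1) M 1 < 1) : HasUniqueSturmLiouvilleSol f₀ n Ω := by
  obtain ⟨F, hF⟩ := exists_isVolterraSol hM hM0 hlt
  simp only [HasUniqueSturmLiouvilleSol, isSturmLiouvilleSol_iff_isVolterraSol hM hν]
  exact ⟨F, hF, fun G hG => hG.eqOn hF hM hM0 hlt⟩

theorem HasUniqueSturmLiouvilleSol.isSturmLiouvilleSol_slSol {f₀ : ℝ → ℝ} {n : ℕ} {Ω : ℝ}
    (h : HasUniqueSturmLiouvilleSol f₀ n Ω) : IsSturmLiouvilleSol f₀ n Ω (slSol f₀ n Ω) :=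
  Classical.epsilon_spec (h.imp fun _ => And.left)

end Volterra

section Profile

/-- A profile `f` on `[0,1]` whose weight `q(r) = f'(r)/r` extends continuously to `r = 0` and takes
its values in `[c, L]` with `c > 0`. -/
structure IsRadialProfile (f q : ℝ → ℝ) (c L : ℝ) : Prop where
  hasDerivWithinAt : ∀ r ∈ Icc (0 : ℝ) 1, HasDerivWithinAt f (r * q r) (Icc 0 1) r
  continuousOn_weight : ContinuousOn q (Icc 0 1)
  pos : 0 < c
  weight_mem : ∀ r ∈ Icc (0 : ℝ) 1, q r ∈ Icc c L

/-- The potential `σ_Ω ν_Ω` for `Ω > κ₂`, extended continuously to `r = 0`; `q` is the weight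
`f'(r)/r`. -/
def potential (f q : ℝ → ℝ) (Ω r : ℝ) : ℝ := q r / (Ω - radialAvg 1 f r)

theorem exists_isRadialProfile {f g : ℝ → ℝ} {c : ℝ} (hg : ContDiffOn ℝ 1 g (Icc 0 1))
    (hfg : ∀ r ∈ Icc (0 : ℝ) 1, f r = g (r ^ 2)) (hc : 0 < c)
    (hinc : ∀ r ∈ Ioc (0 : ℝ) 1, c ≤ derivWithin f (Icc 0 1) r / r) :
    ∃ q L, IsRadialProfile f q c L := by
  have hu := uniqueDiffOn_Icc (zero_lt_one (α := ℝ))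
  have hsq : MapsTo (fun r : ℝ => r ^ 2) (Icc 0 1) (Icc 0 1) := fun r hr =>
    ⟨sq_nonneg r, pow_le_one₀ hr.1 hr.2⟩
  set q : ℝ → ℝ := fun r => 2 * derivWithin g (Icc 0 1) (r ^ 2)
  have hf : ∀ r ∈ Icc (0 : ℝ) 1, HasDerivWithinAt f (r * q r) (Icc 0 1) r := fun r hr => by
    have hg' := (hg.differentiableOn one_ne_zero _ (hsq hr)).hasDerivWithinAt
    refine ((hg'.comp (h := fun x => x ^ 2) r (hasDerivWithinAt_pow 2 r) hsq).congr_of_mem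
      hfg hr).congr_deriv ?_
    simp only [q]
    ring
  have hq : ContinuousOn q (Icc 0 1) := continuousOn_const.mul
    ((hg.continuousOn_derivWithin hu le_rfl).comp (continuousOn_pow 2) hsq)
  have hqc : ∀ r ∈ Icc (0 : ℝ) 1, c ≤ q r := by
    rw [← closure_Ioc zero_ne_one] at hq ⊢
    refine fun r hr => le_on_closure (fun x hx => ?_) continuousOn_const hq hr
    have hx' := Ioc_subset_Icc_self hx
    have := hinc x hx
    rwa [(hf x hx').derivWithin (hu x hx'), mul_div_cancel_left₀ _ hx.1.ne'] at this
  obtain ⟨L, hL⟩ := isCompact_Icc.bddAbove_image hq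
  exact ⟨q, L, hf, hq, hc, fun r hr => ⟨hqc r hr, hL (mem_image_of_mem q hr)⟩⟩

theorem omegaHat_eq (f : ℝ → ℝ) (n : ℕ) :
    omegaHat f n = radialAvg 1 f 1 - (n + 1) / n * radialAvg (2 * n + 1) f 1 := by
  simp only [omegaHat, radialAvg, one_mul, pow_one]

namespace IsRadialProfile

variable {f q : ℝ → ℝ} {c L r Ω Ω' : ℝ}

theorem bound_pos (h : IsRadialProfile f q c L) : 0 < L :=
  have hq := h.weight_mem 0 (left_mem_Icc.2 zero_le_one)
  h.pos.trans_le (hq.1.trans hq.2)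

theorem bound_nonneg (h : IsRadialProfile f q c L) : 0 ≤ L := h.bound_pos.le

theorem continuousOn (h : IsRadialProfile f q c L) : ContinuousOn f (Icc 0 1) := fun r hr =>
  (h.hasDerivWithinAt r hr).continuousWithinAt

theorem monotoneOn_of_forall_nonneg (h : IsRadialProfile f q c L) {a b : ℝ}
    (hab : ∀ r ∈ Icc (0 : ℝ) 1, 0 ≤ a * q r - b) :
    MonotoneOn (fun r => (a • f) r - b / 2 * r ^ 2) (Icc 0 1) := by
  refine monotoneOn_of_hasDerivWithinAt_nonneg (f' := fun r => r * (a * q r - b)) (convex_Icc 0 1)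
    ((h.continuousOn.const_smul a).sub (by fun_prop)) (fun r hr => ?_) fun r hr => ?_
  · have hf := (h.hasDerivWithinAt r (interior_subset hr)).mono interior_subset
    refine ((hf.const_smul a).sub ((hasDerivWithinAt_pow 2 r).const_mul (b / 2))).congr_deriv ?_
    simp only [smul_eq_mul, Nat.cast_ofNat, Nat.add_one_sub_one, pow_one]
    ring
  · exact mul_nonneg (interior_subset hr).1 (hab r (interior_subset hr))

theorem monotoneOn_sub_sq (h : IsRadialProfile f q c L) :
    MonotoneOn (fun r => f r - c / 2 * r ^ 2) (Icc 0 1) := by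
  simpa using h.monotoneOn_of_forall_nonneg (a := 1) (b := c) fun r hr => by
    linarith [(h.weight_mem r hr).1]

theorem monotoneOn_neg_sub_sq (h : IsRadialProfile f q c L) :
    MonotoneOn (fun r => ((-1 : ℝ) • f) r - -L / 2 * r ^ 2) (Icc 0 1) :=
  h.monotoneOn_of_forall_nonneg fun r hr => by linarith [(h.weight_mem r hr).2]

theorem monotoneOn (h : IsRadialProfile f q c L) : MonotoneOn f (Icc 0 1) := by
  simpa using h.monotoneOn_of_forall_nonneg (a := 1) (b := 0) fun r hr => by
    linarith [h.pos, (h.weight_mem r hr).1]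

theorem apply_one_sub_le (h : IsRadialProfile f q c L) (hr : r ∈ Icc (0 : ℝ) 1) :
    f 1 - f r ≤ L / 2 * (1 - r ^ 2) := by
  have := h.monotoneOn_neg_sub_sq hr (right_mem_Icc.2 zero_le_one) hr.2
  simp only [Pi.smul_apply, smul_eq_mul] at this
  linarith

theorem radialAvg_one_sub_mem_Icc (h : IsRadialProfile f q c L) (hr : r ∈ Icc (0 : ℝ) 1) :
    radialAvg 1 f 1 - radialAvg 1 f r ∈ Icc (c / 8 * (1 - r ^ 2)) (L / 8 * (1 - r ^ 2)) := by
  have lower := mul_one_sub_sq_le_radialAvg_sub 1 h.continuousOn h.monotoneOn_sub_sq hr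
  have upper := mul_one_sub_sq_le_radialAvg_sub 1 (h.continuousOn.const_smul _)
    h.monotoneOn_neg_sub_sq hr
  rw [radialAvg_smul, radialAvg_smul] at upper
  push_cast at lower upper
  constructor <;> linarith

theorem sub_radialAvg_one_mem_Icc (h : IsRadialProfile f q c L) (d : ℕ) :
    f 1 / (d + 1) - radialAvg d f 1 ∈ Icc (c / ((d + 1) * (d + 3))) (L / ((d + 1) * (d + 3))) := by
  have lower := mul_sub_le_sub_radialAvg_one d h.continuousOn h.monotoneOn_sub_sq
  have upper := mul_sub_le_sub_radialAvg_one d (h.continuousOn.const_smul _)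
    h.monotoneOn_neg_sub_sq
  rw [radialAvg_smul, Pi.smul_apply, smul_eq_mul, neg_one_mul, neg_one_mul] at upper
  have hfrac : ∀ x : ℝ, x / 2 / (d + 1) - x / 2 / (d + 3) = x / ((d + 1) * (d + 3)) := fun x => by
    field_simp
    ring
  rw [hfrac] at lower upper
  rw [neg_div, neg_div] at upper
  exact ⟨lower, by linarith⟩

theorem kappa₁_eq (h : IsRadialProfile f q c L) : kappa₁ f = radialAvg 1 f 0 := by
  have hmono := monotoneOn_radialAvg 1 h.continuousOn h.monotoneOn
  have h0 : (0 : ℝ) ∈ Icc (0 : ℝ) 1 := left_mem_Icc.2 zero_le_one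
  have hleast : IsLeast (range fun r : Icc (0 : ℝ) 1 => radialAvg 1 f r) (radialAvg 1 f 0) :=
    ⟨⟨⟨0, h0⟩, rfl⟩, by rintro _ ⟨r, rfl⟩; exact hmono h0 r.2 r.2.1⟩
  simpa only [kappa₁, iInf, radialAvg, pow_one] using hleast.csInf_eq

theorem kappa₂_eq (h : IsRadialProfile f q c L) : kappa₂ f = radialAvg 1 f 1 := by
  have hmono := monotoneOn_radialAvg 1 h.continuousOn h.monotoneOn
  have h1 : (1 : ℝ) ∈ Icc (0 : ℝ) 1 := right_mem_Icc.2 zero_le_one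
  have hgreatest : IsGreatest (range fun r : Icc (0 : ℝ) 1 => radialAvg 1 f r) (radialAvg 1 f 1) :=
    ⟨⟨⟨1, h1⟩, rfl⟩, by rintro _ ⟨r, rfl⟩; exact hmono r.2 h1 r.2.2⟩
  simpa only [kappa₂, iSup, radialAvg, pow_one] using hgreatest.csSup_eq

theorem apply_one_sub_two_mul_kappa₂_mem_Icc (h : IsRadialProfile f q c L) :
    f 1 - 2 * kappa₂ f ∈ Icc (c / 4) (L / 4) := by
  have := h.sub_radialAvg_one_mem_Icc 1
  push_cast at this
  rw [h.kappa₂_eq]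
  exact ⟨by linarith [this.1], by linarith [this.2]⟩

theorem omegaHat_sub_kappa₂_mem_Icc (h : IsRadialProfile f q c L) {n : ℕ} (hn : 1 ≤ n) :
    omegaHat f n - kappa₂ f ∈ Icc (-f 1 / (2 * n)) (-f 1 / (2 * n) + L / (4 * n ^ 2)) := by
  have hn0 : (0 : ℝ) < n := by exact_mod_cast hn
  obtain ⟨lower, upper⟩ := h.sub_radialAvg_one_mem_Icc (2 * n + 1)
  push_cast at lower upper
  set e := f 1 / (2 * n + 1 + 1) - radialAvg (2 * n + 1) f 1 with he
  have hsub : omegaHat f n - kappa₂ f = -f 1 / (2 * n) + (n + 1) / n * e := by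
    rw [omegaHat_eq, h.kappa₂_eq, he]
    field_simp
    ring
  have he0 : 0 ≤ e := le_trans (div_nonneg h.pos.le (by positivity)) lower
  have heL : (n + 1) / n * e ≤ L / (4 * n ^ 2) := calc
    (n + 1) / n * e ≤ (n + 1) / n * (L / ((2 * n + 1 + 1) * (2 * n + 1 + 3))) :=
      mul_le_mul_of_nonneg_left upper (by positivity)
    _ = L / (4 * (n * (n + 2))) := by field_simp; ring
    _ ≤ L / (4 * n ^ 2) := div_le_div_of_nonneg_left h.bound_nonneg (by positivity) (by nlinarith)
  rw [hsub]
  exact ⟨le_add_of_nonneg_right (by positivity), by linarith⟩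

theorem sub_radialAvg_mem_Icc (h : IsRadialProfile f q c L) (Ω : ℝ) (hr : r ∈ Icc (0 : ℝ) 1) :
    Ω - radialAvg 1 f r ∈
      Icc (Ω - kappa₂ f + c / 8 * (1 - r ^ 2)) (Ω - kappa₂ f + L / 8 * (1 - r ^ 2)) := by
  have := h.radialAvg_one_sub_mem_Icc hr
  rw [h.kappa₂_eq]
  exact ⟨by linarith [this.1], by linarith [this.2]⟩

theorem sub_kappa₂_le (h : IsRadialProfile f q c L) (Ω : ℝ) (hr : r ∈ Icc (0 : ℝ) 1) :
    Ω - kappa₂ f ≤ Ω - radialAvg 1 f r := by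
  have hr2 : 0 ≤ 1 - r ^ 2 := sub_nonneg.2 (pow_le_one₀ hr.1 hr.2)
  have hc := h.pos
  exact (le_add_of_nonneg_right (by positivity)).trans (h.sub_radialAvg_mem_Icc Ω hr).1

theorem continuousOn_potential (h : IsRadialProfile f q c L) (hΩ : kappa₂ f < Ω) :
    ContinuousOn (potential f q Ω) (Icc 0 1) :=
  h.continuousOn_weight.div (continuousOn_const.sub (continuousOn_radialAvg 1 h.continuousOn))
    fun _ hr => ((sub_pos.2 hΩ).trans_le (h.sub_kappa₂_le Ω hr)).ne'

theorem le_potential (h : IsRadialProfile f q c L) (hΩ : kappa₂ f < Ω)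
    (hr : r ∈ Icc (0 : ℝ) 1) : c / (Ω - kappa₂ f + L / 8) ≤ potential f q Ω r := by
  have hpos := (sub_pos.2 hΩ).trans_le (h.sub_kappa₂_le Ω hr)
  have hL := h.bound_nonneg
  have hq := h.weight_mem r hr
  refine div_le_div₀ (h.pos.le.trans hq.1) hq.1 hpos ((h.sub_radialAvg_mem_Icc Ω hr).2.trans ?_)
  nlinarith [sq_nonneg r]

theorem potential_nonneg (h : IsRadialProfile f q c L) (hΩ : kappa₂ f < Ω)
    (hr : r ∈ Icc (0 : ℝ) 1) : 0 ≤ potential f q Ω r :=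
  div_nonneg (h.pos.le.trans (h.weight_mem r hr).1)
    ((sub_pos.2 hΩ).le.trans (h.sub_kappa₂_le Ω hr))

theorem potential_le_div (h : IsRadialProfile f q c L) (hΩ : kappa₂ f < Ω)
    (hr : r ∈ Icc (0 : ℝ) 1) :
    potential f q Ω r ≤ L / (Ω - kappa₂ f + c / 8 * (1 - r ^ 2)) := by
  have hr2 : 0 ≤ 1 - r ^ 2 := sub_nonneg.2 (pow_le_one₀ hr.1 hr.2)
  have hc := h.pos
  have := sub_pos.2 hΩ
  exact div_le_div₀ h.bound_nonneg (h.weight_mem r hr).2 (by positivity)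
    (h.sub_radialAvg_mem_Icc Ω hr).1

theorem potential_le (h : IsRadialProfile f q c L) (hΩ : kappa₂ f < Ω)
    (hr : r ∈ Icc (0 : ℝ) 1) : potential f q Ω r ≤ L / (Ω - kappa₂ f) :=
  div_le_div₀ h.bound_nonneg (h.weight_mem r hr).2 (sub_pos.2 hΩ) (h.sub_kappa₂_le Ω hr)

theorem abs_potential_sub_le (h : IsRadialProfile f q c L) {a : ℝ} (ha : 0 < a)
    (hΩ : kappa₂ f + a ≤ Ω) (hΩ' : kappa₂ f + a ≤ Ω') (hr : r ∈ Icc (0 : ℝ) 1) :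
    |potential f q Ω r - potential f q Ω' r| ≤ L / a ^ 2 * |Ω - Ω'| := by
  have hD : a ≤ Ω - radialAvg 1 f r := le_trans (by linarith) (h.sub_kappa₂_le Ω hr)
  have hD' : a ≤ Ω' - radialAvg 1 f r := le_trans (by linarith) (h.sub_kappa₂_le Ω' hr)
  have hq := h.weight_mem r hr
  have hsub : potential f q Ω r - potential f q Ω' r
      = q r * (Ω' - Ω) / ((Ω - radialAvg 1 f r) * (Ω' - radialAvg 1 f r)) := by
    rw [potential, potential, div_sub_div _ _ (ha.trans_le hD).ne' (ha.trans_le hD').ne']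
    ring
  rw [hsub, abs_div, abs_mul, abs_mul, abs_of_nonneg (h.pos.le.trans hq.1),
    abs_of_nonneg (ha.le.trans hD), abs_of_nonneg (ha.le.trans hD'), abs_sub_comm,
    div_mul_eq_mul_div, sq]
  have := h.bound_nonneg
  have := ha.le.trans hD
  gcongr
  exact hq.2

theorem sigma_mul_nu_eq_potential (h : IsRadialProfile f q c L) (hΩ : kappa₂ f < Ω)
    (hr : r ∈ Ioo (0 : ℝ) 1) : sigma f Ω * nu f Ω r = potential f q Ω r := by
  have hr' := Ioo_subset_Icc_self hr
  have hκ : kappa₁ f ≤ kappa₂ f := by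
    rw [h.kappa₁_eq, h.kappa₂_eq]
    exact monotoneOn_radialAvg 1 h.continuousOn h.monotoneOn (left_mem_Icc.2 zero_le_one)
      (right_mem_Icc.2 zero_le_one) zero_le_one
  have hσ : sigma f Ω = 1 := by rw [sigma, if_neg (hκ.trans hΩ.le).not_gt, if_pos hΩ]
  have havg : ∫ s in (0 : ℝ)..1, s * f (s * r) = radialAvg 1 f r := by
    simp only [radialAvg, pow_one, mul_comm r]
  rw [nu, hσ, one_mul, one_mul, mu0, havg, potential,
    (h.hasDerivWithinAt r hr').derivWithin (uniqueDiffOn_Icc zero_lt_one r hr'),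
    mul_div_mul_left _ _ hr.1.ne']

end IsRadialProfile

end Profile

section Integrals

theorem integral_pow_mul_one_sub_sq_pow (n k : ℕ) :
    ∫ s in (0 : ℝ)..1, s ^ (2 * n + 1) * (1 - s ^ 2) ^ k
      = (k.factorial : ℝ) / (2 * ((n + 1).ascFactorial (k + 1) : ℝ)) := by
  induction k generalizing n with
  | zero =>
    simp only [pow_zero, mul_one, integral_pow, Nat.factorial_zero, Nat.ascFactorial_succ,
      Nat.ascFactorial_zero]
    rw [one_pow, zero_pow (Nat.succ_ne_zero _)]
    push_cast
    field_simp
    ring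
  | succ k ih =>
    have hderiv : ∀ s ∈ uIcc (0 : ℝ) 1, HasDerivAt
        (fun s => s ^ (2 * n + 2) * (1 - s ^ 2) ^ (k + 1))
        (2 * (n + 1) * (s ^ (2 * n + 1) * (1 - s ^ 2) ^ (k + 1))
          - 2 * (k + 1) * (s ^ (2 * (n + 1) + 1) * (1 - s ^ 2) ^ k)) s := fun s _ => by
      refine ((hasDerivAt_pow (2 * n + 2) s).fun_mul
        (((hasDerivAt_pow 2 s).const_sub 1).fun_pow (k + 1))).congr_deriv ?_
      simp only [Nat.add_sub_cancel, show 2 * n + 2 - 1 = 2 * n + 1 from rfl]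
      push_cast
      ring
    have hftc := intervalIntegral.integral_eq_sub_of_hasDerivAt hderiv
      (Continuous.intervalIntegrable (by fun_prop) _ _)
    rw [intervalIntegral.integral_sub (Continuous.intervalIntegrable (by fun_prop) _ _)
      (Continuous.intervalIntegrable (by fun_prop) _ _), intervalIntegral.integral_const_mul,
      intervalIntegral.integral_const_mul, ih (n + 1)] at hftc
    have hasc : (n + 1) * (n + 1 + 1).ascFactorial (k + 1) = (n + 1).ascFactorial (k + 1 + 1) := by
      rw [Nat.ascFactorial_succ (k := k + 1)]
      exact Nat.succ_ascFactorial (n + 1) (k + 1)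
    have : (0 : ℝ) < (n + 1 + 1).ascFactorial (k + 1) := by
      exact_mod_cast Nat.ascFactorial_pos _ _
    rw [← hasc, Nat.factorial_succ]
    push_cast
    field_simp at hftc ⊢
    simp only [one_pow, sub_self, zero_pow (Nat.succ_ne_zero _), mul_zero, zero_mul,
      sub_zero] at hftc
    linarith

theorem integral_id_div_add_mul_one_sub_sq {a k : ℝ} (ha : 0 < a) (hk : 0 < k) :
    ∫ s in (0 : ℝ)..1, s / (a + k * (1 - s ^ 2)) = Real.log (1 + k / a) / (2 * k) := by
  have hpos : ∀ s ∈ uIcc (0 : ℝ) 1, 0 < a + k * (1 - s ^ 2) := fun s hs => by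
    rw [uIcc_of_le zero_le_one] at hs
    have : 0 ≤ 1 - s ^ 2 := sub_nonneg.2 (pow_le_one₀ hs.1 hs.2)
    positivity
  have hderiv : ∀ s ∈ uIcc (0 : ℝ) 1, HasDerivAt
      (fun s => -(Real.log (a + k * (1 - s ^ 2)) / (2 * k))) (s / (a + k * (1 - s ^ 2))) s :=
    fun s hs => by
      refine ((((((hasDerivAt_pow 2 s).const_sub 1).const_mul k).const_add a).log
        (hpos s hs).ne').div_const (2 * k)).fun_neg.congr_deriv ?_
      field_simp [(hpos s hs).ne']
      simp only [Nat.cast_ofNat, Nat.add_one_sub_one, pow_one, mul_comm]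
  rw [intervalIntegral.integral_eq_sub_of_hasDerivAt hderiv (ContinuousOn.intervalIntegrable
    (continuousOn_id.div (by fun_prop) fun s hs => (hpos s hs).ne'))]
  have hlog : Real.log (1 + k / a) = Real.log (a + k) - Real.log a := by
    rw [← Real.log_div (by positivity) ha.ne']
    congr 1
    field_simp
  rw [hlog, one_pow, sub_self, mul_zero, add_zero, zero_pow two_ne_zero, sub_zero, mul_one]
  ring

theorem tendsto_log_one_add_mul_div_atTop {k : ℝ} (hk : 0 < k) :
    Tendsto (fun x : ℝ => Real.log (1 + k * x) / x) atTop (𝓝 0) := by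
  have hlin : Tendsto (fun x : ℝ => 1 + k * x) atTop atTop :=
    tendsto_atTop_add_const_left _ _ (tendsto_id.const_mul_atTop hk)
  have hlog := Real.isLittleO_log_id_atTop.tendsto_div_nhds_zero.comp hlin
  have hratio := (tendsto_inv_atTop_zero (𝕜 := ℝ)).add_const k
  have hprod := hlog.mul hratio
  rw [zero_mul] at hprod
  refine hprod.congr' ?_
  filter_upwards [eventually_gt_atTop 0] with x hx
  simp only [Function.comp, id]
  field_simp

end Integrals

section Mode

/-- A frequency `Ω ∈ (κ₂, κ₂ + 1]` at which the potential is so small, after averaging, that the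
solution of the mode `n` stays in `[2/3, 4/3]`. -/
structure IsAdmissible (f q : ℝ → ℝ) (n : ℕ) (Ω : ℝ) : Prop where
  kappa₂_lt : kappa₂ f < Ω
  le_add_one : Ω ≤ kappa₂ f + 1
  radialPrimitive_le : radialPrimitive (2 * n + 1) (potential f q Ω) 1 ≤ 1 / 4

/-- What remains of `ζ_n(Ω)` after replacing `F_{n,Ω}` by the constant `F_{n,Ω}(1)`. -/
def zetaRemainder (f : ℝ → ℝ) (n : ℕ) (Ω : ℝ) : ℝ :=
  ∫ s in (0 : ℝ)..1, (slSol f n Ω s - slSol f n Ω 1) * (s ^ (2 * n + 1) * (f s - 2 * Ω))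

namespace IsRadialProfile

variable {f q : ℝ → ℝ} {c L r Ω Ω' : ℝ} {n : ℕ}

theorem integral_id_mul_potential_le (h : IsRadialProfile f q c L) (hΩ : kappa₂ f < Ω) :
    ∫ s in (0 : ℝ)..1, s * potential f q Ω s
      ≤ 4 * L / c * Real.log (1 + c / (8 * (Ω - kappa₂ f))) := by
  have hc := h.pos
  have ha := sub_pos.2 hΩ
  have hpos : ∀ s ∈ Icc (0 : ℝ) 1, Ω - kappa₂ f + c / 8 * (1 - s ^ 2) ≠ 0 := fun s hs => by
    have : 0 ≤ 1 - s ^ 2 := sub_nonneg.2 (pow_le_one₀ hs.1 hs.2)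
    positivity
  calc ∫ s in (0 : ℝ)..1, s * potential f q Ω s
      ≤ ∫ s in (0 : ℝ)..1, L * (s / (Ω - kappa₂ f + c / 8 * (1 - s ^ 2))) := by
        refine intervalIntegral.integral_mono_on zero_le_one
          ((continuousOn_id.mul (h.continuousOn_potential hΩ)).intervalIntegrable_of_Icc
            zero_le_one)
          ((continuousOn_const.mul
            (continuousOn_id.div (by fun_prop) hpos)).intervalIntegrable_of_Icc zero_le_one)
          fun s hs => ?_
        rw [mul_div_left_comm]
        exact mul_le_mul_of_nonneg_left (h.potential_le_div hΩ hs) hs.1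
    _ = 4 * L / c * Real.log (1 + c / (8 * (Ω - kappa₂ f))) := by
        rw [intervalIntegral.integral_const_mul,
          integral_id_div_add_mul_one_sub_sq ha (by positivity), div_div]
        ring

theorem eventually_isAdmissible (h : IsRadialProfile f q c L) {a : ℝ} (ha : 0 < a) :
    ∀ᶠ m : ℕ in atTop, ∀ n Ω, m ≤ n → kappa₂ f + a / m ≤ Ω → Ω ≤ kappa₂ f + 1 →
      IsAdmissible f q n Ω := by
  have hc := h.pos
  have hlim := ((tendsto_log_one_add_mul_div_atTop (k := c / (8 * a)) (by positivity)).comp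
    tendsto_natCast_atTop_atTop).const_mul (4 * L / c)
  rw [mul_zero] at hlim
  filter_upwards [hlim.eventually_le_const (u := 1 / 2) (by norm_num), eventually_ge_atTop 1]
    with m hm hm1 n Ω hn hΩ hΩ1
  have hm0 : (0 : ℝ) < m := by exact_mod_cast hm1
  have hn0 : (m : ℝ) ≤ n := by exact_mod_cast hn
  have hκ : kappa₂ f < Ω := (lt_add_of_pos_right _ (by positivity)).trans_le hΩ
  have hprim := sub_one_mul_radialPrimitive_one_le (2 * n + 1) (h.continuousOn_potential hκ)
    fun _ => h.potential_nonneg hκ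
  have hlog : 4 * L / c * Real.log (1 + c / (8 * (Ω - kappa₂ f))) ≤ m / 2 := by
    have hfrac : c / (8 * (Ω - kappa₂ f)) ≤ c / (8 * a) * m := calc
      c / (8 * (Ω - kappa₂ f)) ≤ c / (8 * (a / m)) := by
        have : a / m ≤ Ω - kappa₂ f := by linarith
        gcongr
      _ = c / (8 * a) * m := by field_simp
    have hL := h.bound_nonneg
    have := sub_pos.2 hκ
    simp only [Function.comp_apply, ← mul_div_assoc, div_le_iff₀ hm0] at hm
    calc 4 * L / c * Real.log (1 + c / (8 * (Ω - kappa₂ f)))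
        ≤ 4 * L / c * Real.log (1 + c / (8 * a) * m) := by gcongr
      _ ≤ m / 2 := by linarith
  have hint := h.integral_id_mul_potential_le hκ
  push_cast at hprim
  exact ⟨hκ, hΩ1, by nlinarith⟩

theorem hasUniqueSturmLiouvilleSol (h : IsRadialProfile f q c L) (hΩ : IsAdmissible f q n Ω) :
    HasUniqueSturmLiouvilleSol f n Ω :=
  hasUniqueSturmLiouvilleSol_of_radialPrimitive_lt (h.continuousOn_potential hΩ.kappa₂_lt)
    (fun _ => h.potential_nonneg hΩ.kappa₂_lt)
    (fun _ => h.sigma_mul_nu_eq_potential hΩ.kappa₂_lt)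
    (hΩ.radialPrimitive_le.trans_lt (by norm_num))

theorem isVolterraSol_slSol (h : IsRadialProfile f q c L) (hΩ : IsAdmissible f q n Ω) :
    IsVolterraSol (2 * n + 1) (potential f q Ω) (slSol f n Ω) :=
  (isSturmLiouvilleSol_iff_isVolterraSol (h.continuousOn_potential hΩ.kappa₂_lt)
    fun _ => h.sigma_mul_nu_eq_potential hΩ.kappa₂_lt).1
    (h.hasUniqueSturmLiouvilleSol hΩ).isSturmLiouvilleSol_slSol

theorem slSol_mem_Icc (h : IsRadialProfile f q c L) (hΩ : IsAdmissible f q n Ω)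
    (hr : r ∈ Icc (0 : ℝ) 1) : slSol f n Ω r ∈ Icc (2 / 3 : ℝ) (4 / 3) := by
  have hp := hΩ.radialPrimitive_le
  have hle := (h.isVolterraSol_slSol hΩ).abs_sub_one_le (h.continuousOn_potential hΩ.kappa₂_lt)
    (fun _ => h.potential_nonneg hΩ.kappa₂_lt) (hp.trans_lt (by norm_num)) hr
  have hthird : |slSol f n Ω r - 1| ≤ 1 / 3 :=
    hle.trans ((div_le_iff₀ (by linarith)).2 (by linarith))
  rw [abs_le] at hthird
  constructor <;> linarith

theorem slSol_sub_slSol_one_mem_Icc (h : IsRadialProfile f q c L) (hΩ : IsAdmissible f q n Ω)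
    (hr : r ∈ Icc (0 : ℝ) 1) :
    slSol f n Ω r - slSol f n Ω 1 ∈ Icc (c / (6 * (1 + L) * (n + 1)) * (1 - r ^ 2))
      (L / (3 * (Ω - kappa₂ f) * (n + 1)) * (1 - r ^ 2)) := by
  have h1 := right_mem_Icc.2 (zero_le_one (α := ℝ))
  have hc := h.pos
  have hL := h.bound_nonneg
  have hκ := sub_pos.2 hΩ.kappa₂_lt
  have hF := h.isVolterraSol_slSol hΩ
  have hMF := (h.continuousOn_potential hΩ.kappa₂_lt).mul hF.continuousOn
  have lower : ∀ x ∈ Icc (0 : ℝ) 1,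
      c / (1 + L) * (2 / 3) ≤ (potential f q Ω * slSol f n Ω) x := fun x hx => by
    have hpot : c / (1 + L) ≤ potential f q Ω x := le_trans
      (div_le_div_of_nonneg_left hc.le (by positivity) (by linarith [hΩ.le_add_one]))
      (h.le_potential hΩ.kappa₂_lt hx)
    exact mul_le_mul hpot (h.slSol_mem_Icc hΩ hx).1 (by norm_num)
      (h.potential_nonneg hΩ.kappa₂_lt hx)
  have upper : ∀ x ∈ Icc (0 : ℝ) 1,
      (potential f q Ω * slSol f n Ω) x ≤ L / (Ω - kappa₂ f) * (4 / 3) := fun x hx =>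
    mul_le_mul (h.potential_le hΩ.kappa₂_lt hx) (h.slSol_mem_Icc hΩ hx).2
      ((by norm_num : (0 : ℝ) ≤ 2 / 3).trans (h.slSol_mem_Icc hΩ hx).1) (by positivity)
  have hlow := radialPrimitive_sub_le_sub (2 * n + 1) continuousOn_const hMF lower hr h1 hr.2
  have hupp := radialPrimitive_sub_le_sub (2 * n + 1) hMF continuousOn_const upper hr h1 hr.2
  rw [radialPrimitive_const, radialPrimitive_const] at hlow hupp
  push_cast at hlow hupp
  have hdiff : slSol f n Ω r - slSol f n Ω 1
      = radialPrimitive (2 * n + 1) (potential f q Ω * slSol f n Ω) 1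
        - radialPrimitive (2 * n + 1) (potential f q Ω * slSol f n Ω) r := by
    rw [hF.eq r hr, hF.eq 1 h1]
    ring
  rw [hdiff]
  refine ⟨hlow.trans_eq' ?_, hupp.trans_eq ?_⟩ <;> field_simp <;> ring

theorem abs_slSol_sub_le (h : IsRadialProfile f q c L) {a : ℝ} (ha : 0 < a)
    (hΩ : IsAdmissible f q n Ω) (hΩ' : IsAdmissible f q n Ω') (haΩ : kappa₂ f + a ≤ Ω)
    (haΩ' : kappa₂ f + a ≤ Ω') (hr : r ∈ Icc (0 : ℝ) 1) :
    |slSol f n Ω r - slSol f n Ω' r| ≤ L / a ^ 2 * |Ω - Ω'| * (4 / 3) / (3 / 4) := by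
  have hp := hΩ.radialPrimitive_le
  have hle := (h.isVolterraSol_slSol hΩ).abs_sub_le_of_abs_sub_le (h.isVolterraSol_slSol hΩ')
    (h.continuousOn_potential hΩ.kappa₂_lt) (h.continuousOn_potential hΩ'.kappa₂_lt)
    (fun _ => h.potential_nonneg hΩ.kappa₂_lt) (hp.trans_lt (by norm_num))
    (fun _ hx => h.abs_potential_sub_le ha haΩ haΩ' hx)
    (fun _ hx => abs_le.2 ⟨by linarith [(h.slSol_mem_Icc hΩ' hx).1],
      (h.slSol_mem_Icc hΩ' hx).2⟩) hr
  have hL := h.bound_nonneg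
  exact hle.trans (div_le_div_of_nonneg_left (by positivity) (by norm_num) (by linarith))

theorem sub_two_mul_mem_Icc (h : IsRadialProfile f q c L) (hΩ : IsAdmissible f q n Ω)
    (hr : r ∈ Icc (0 : ℝ) 1) :
    f r - 2 * Ω ∈ Icc (c / 4 - L / 2 * (1 - r ^ 2) - 2 * (Ω - kappa₂ f)) (L + 2) := by
  have hf := h.apply_one_sub_two_mul_kappa₂_mem_Icc
  have := h.apply_one_sub_le hr
  have := h.monotoneOn hr (right_mem_Icc.2 zero_le_one) hr.2
  have := h.bound_nonneg
  have := hΩ.kappa₂_lt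
  constructor <;> linarith [hf.1, hf.2]

theorem abs_sub_two_mul_le (h : IsRadialProfile f q c L) (hΩ : IsAdmissible f q n Ω)
    (hr : r ∈ Icc (0 : ℝ) 1) : |f r - 2 * Ω| ≤ L + 2 := by
  have hmem := h.sub_two_mul_mem_Icc hΩ hr
  have := hΩ.le_add_one
  have := h.pos
  have := h.bound_nonneg
  exact abs_le.2 ⟨by nlinarith [hmem.1, sq_nonneg r], hmem.2⟩

theorem le_sub_two_mul (h : IsRadialProfile f q c L) (hΩ : IsAdmissible f q n Ω)
    (hle : Ω ≤ kappa₂ f + c / 32) (hr : r ∈ Icc (0 : ℝ) 1) :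
    c / 8 - L ^ 2 / c * (1 - r ^ 2) ^ 2 ≤ f r - 2 * Ω := by
  have hc := h.pos
  have amgm : L / 2 * (1 - r ^ 2) ≤ c / 16 + L ^ 2 / c * (1 - r ^ 2) ^ 2 := by
    have hsq : c / 16 + L ^ 2 / c * (1 - r ^ 2) ^ 2 - L / 2 * (1 - r ^ 2)
        = (c / 4 - L * (1 - r ^ 2)) ^ 2 / c := by
      field_simp
      ring
    linarith [div_nonneg (sq_nonneg (c / 4 - L * (1 - r ^ 2))) hc.le]
  linarith [(h.sub_two_mul_mem_Icc hΩ hr).1]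

theorem continuousOn_pow_mul_sub (h : IsRadialProfile f q c L) (n : ℕ) (Ω : ℝ) :
    ContinuousOn (fun s => s ^ (2 * n + 1) * (f s - 2 * Ω)) (Icc 0 1) :=
  (continuousOn_pow _).mul (h.continuousOn.sub continuousOn_const)

theorem continuousOn_zetaRemainder_integrand (h : IsRadialProfile f q c L)
    (hΩ : IsAdmissible f q n Ω) :
    ContinuousOn (fun s => (slSol f n Ω s - slSol f n Ω 1) * (s ^ (2 * n + 1) * (f s - 2 * Ω)))
      (Icc 0 1) :=
  ((h.isVolterraSol_slSol hΩ).continuousOn.sub continuousOn_const).mul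
    (h.continuousOn_pow_mul_sub n Ω)

theorem zeta_eq (h : IsRadialProfile f q c L) (hn : 1 ≤ n) (hΩ : IsAdmissible f q n Ω) :
    zeta f n Ω
      = slSol f n Ω 1 * (n / (n + 1) * (Ω - omegaHat f n)) + zetaRemainder f n Ω := by
  have : (0 : ℝ) < n := by exact_mod_cast hn
  have hweight : ∫ s in (0 : ℝ)..1, s ^ (2 * n + 1) * (f s - 2 * Ω)
      = radialAvg (2 * n + 1) f 1 - Ω / (n + 1) := by
    have havg := radialAvg_sub (2 * n + 1) h.continuousOn (continuousOn_const (c := 2 * Ω))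
      (right_mem_Icc.2 zero_le_one)
    rw [radialAvg_const] at havg
    simp only [radialAvg, one_mul, Pi.sub_apply] at havg ⊢
    rw [havg]
    push_cast
    field_simp
    ring
  have hrem : zetaRemainder f n Ω
      = (∫ s in (0 : ℝ)..1, slSol f n Ω s * s ^ (2 * n + 1) * (f s - 2 * Ω))
        - slSol f n Ω 1 * (radialAvg (2 * n + 1) f 1 - Ω / (n + 1)) := by
    have hsol : IntervalIntegrable
        (fun s => slSol f n Ω s * (s ^ (2 * n + 1) * (f s - 2 * Ω))) MeasureTheory.volume 0 1 :=
      ((h.isVolterraSol_slSol hΩ).continuousOn.mul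
        (h.continuousOn_pow_mul_sub n Ω)).intervalIntegrable_of_Icc zero_le_one
    have hweight_int := (h.continuousOn_pow_mul_sub n Ω).intervalIntegrable_of_Icc zero_le_one
      (μ := MeasureTheory.volume)
    simp only [zetaRemainder, sub_mul _ (slSol f n Ω 1), mul_assoc (slSol f n Ω _)]
    rw [intervalIntegral.integral_sub hsol (hweight_int.const_mul _),
      intervalIntegral.integral_const_mul, hweight]
  have havg : ∫ s in (0 : ℝ)..1, s * f s = radialAvg 1 f 1 := by
    simp only [radialAvg, one_mul, pow_one]
  rw [hrem, zeta, omegaHat_eq, havg]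
  field_simp
  ring

theorem abs_zetaRemainder_le (h : IsRadialProfile f q c L) (hΩ : IsAdmissible f q n Ω) :
    |zetaRemainder f n Ω| ≤ L * (L + 2) / (6 * (Ω - kappa₂ f) * ((n + 1) ^ 2 * (n + 2))) := by
  have hκ := sub_pos.2 hΩ.kappa₂_lt
  have hL := h.bound_nonneg
  have hmoment := integral_pow_mul_one_sub_sq_pow n 1
  simp only [pow_one, Nat.ascFactorial_succ, Nat.ascFactorial_zero, Nat.factorial_one] at hmoment
  rw [zetaRemainder, ← Real.norm_eq_abs]
  calc _ ≤ ∫ s in (0 : ℝ)..1, L / (3 * (Ω - kappa₂ f) * (n + 1)) * (L + 2)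
          * (s ^ (2 * n + 1) * (1 - s ^ 2)) := by
        refine intervalIntegral.norm_integral_le_of_norm_le zero_le_one
          (.of_forall fun s hs => ?_) (Continuous.intervalIntegrable (by fun_prop) _ _)
        have hs' := Ioc_subset_Icc_self hs
        have hosc := h.slSol_sub_slSol_one_mem_Icc hΩ hs'
        have hf := h.abs_sub_two_mul_le hΩ hs'
        have hs2 : 0 ≤ 1 - s ^ 2 := sub_nonneg.2 (pow_le_one₀ hs'.1 hs'.2)
        have hc := h.pos
        have hpow : 0 ≤ s ^ (2 * n + 1) := pow_nonneg hs'.1 _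
        rw [Real.norm_eq_abs, abs_mul, abs_mul, abs_of_nonneg hpow,
          abs_of_nonneg (le_trans (by positivity) hosc.1)]
        calc _ ≤ L / (3 * (Ω - kappa₂ f) * (n + 1)) * (1 - s ^ 2)
                * (s ^ (2 * n + 1) * (L + 2)) := by
              gcongr
              exact hosc.2
          _ = _ := by ring
    _ = _ := by
        rw [intervalIntegral.integral_const_mul, hmoment]
        push_cast
        field_simp
        ring

theorem one_third_le_slSol_one_mul (h : IsRadialProfile f q c L) (hn : 1 ≤ n)
    (hΩ : IsAdmissible f q n Ω) : 1 / 3 ≤ slSol f n Ω 1 * (n / (n + 1)) := by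
  have hn1 : (1 : ℝ) ≤ n := by exact_mod_cast hn
  have hratio : (1 / 2 : ℝ) ≤ n / (n + 1) := by rw [div_le_div_iff₀] <;> linarith
  calc (1 / 3 : ℝ) = 2 / 3 * (1 / 2) := by norm_num
    _ ≤ slSol f n Ω 1 * (n / (n + 1)) :=
      mul_le_mul (h.slSol_mem_Icc hΩ (right_mem_Icc.2 zero_le_one)).1 hratio (by norm_num)
        (le_trans (by norm_num) (h.slSol_mem_Icc hΩ (right_mem_Icc.2 zero_le_one)).1)

theorem zeta_pos_of_lt (h : IsRadialProfile f q c L) (hn : 1 ≤ n) (hΩ : IsAdmissible f q n Ω)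
    (hlt : 4 * |zetaRemainder f n Ω| < Ω - omegaHat f n) : 0 < zeta f n Ω := by
  have hcoeff := h.one_third_le_slSol_one_mul hn hΩ
  rw [h.zeta_eq hn hΩ, ← mul_assoc]
  nlinarith [neg_abs_le (zetaRemainder f n Ω), abs_nonneg (zetaRemainder f n Ω)]

theorem zeta_neg_of_lt (h : IsRadialProfile f q c L) (hn : 1 ≤ n) (hΩ : IsAdmissible f q n Ω)
    (hlt : 4 * |zetaRemainder f n Ω| < omegaHat f n - Ω) : zeta f n Ω < 0 := by
  have hcoeff := h.one_third_le_slSol_one_mul hn hΩ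
  rw [h.zeta_eq hn hΩ, ← mul_assoc]
  nlinarith [le_abs_self (zetaRemainder f n Ω), abs_nonneg (zetaRemainder f n Ω)]

theorem le_slSol_sub_mul (h : IsRadialProfile f q c L) (hΩ : IsAdmissible f q n Ω)
    (hle : Ω ≤ kappa₂ f + c / 32) (hr : r ∈ Icc (0 : ℝ) 1) :
    c / 8 * (c / (6 * (1 + L) * (n + 1))) * (r ^ (2 * n + 1) * (1 - r ^ 2) ^ 1)
      - L ^ 2 / c * (L / (3 * (Ω - kappa₂ f) * (n + 1))) * (r ^ (2 * n + 1) * (1 - r ^ 2) ^ 3)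
      ≤ (slSol f n Ω r - slSol f n Ω 1) * (r ^ (2 * n + 1) * (f r - 2 * Ω)) := by
  have hL := h.bound_nonneg
  have hc := h.pos
  obtain ⟨hlower, hupper⟩ := h.slSol_sub_slSol_one_mem_Icc hΩ hr
  have hf := h.le_sub_two_mul hΩ hle hr
  have hr2 : 0 ≤ 1 - r ^ 2 := sub_nonneg.2 (pow_le_one₀ hr.1 hr.2)
  have hG : 0 ≤ slSol f n Ω r - slSol f n Ω 1 := le_trans (by positivity) hlower
  have hpow : 0 ≤ r ^ (2 * n + 1) := pow_nonneg hr.1 _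
  set x := 1 - r ^ 2
  set G := slSol f n Ω r - slSol f n Ω 1
  set γ := c / (6 * (1 + L) * (n + 1))
  set W := L / (3 * (Ω - kappa₂ f) * (n + 1))
  calc c / 8 * γ * (r ^ (2 * n + 1) * x ^ 1) - L ^ 2 / c * W * (r ^ (2 * n + 1) * x ^ 3)
      = r ^ (2 * n + 1) * (c / 8 * (γ * x) - L ^ 2 / c * x ^ 2 * (W * x)) := by ring
    _ ≤ r ^ (2 * n + 1) * (c / 8 * G - L ^ 2 / c * x ^ 2 * G) := by gcongr
    _ = G * (r ^ (2 * n + 1) * (c / 8 - L ^ 2 / c * x ^ 2)) := by ring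
    _ ≤ G * (r ^ (2 * n + 1) * (f r - 2 * Ω)) := by gcongr

theorem zetaRemainder_pos (h : IsRadialProfile f q c L) (hΩ : IsAdmissible f q n Ω)
    (hle : Ω ≤ kappa₂ f + c / 32)
    (hlt : 96 * L ^ 3 * (1 + L) < c ^ 3 * (Ω - kappa₂ f) * ((n + 3) * (n + 4))) :
    0 < zetaRemainder f n Ω := by
  have hκ := sub_pos.2 hΩ.kappa₂_lt
  have hL := h.bound_nonneg
  have hc := h.pos
  have hint := intervalIntegral.integral_mono_on zero_le_one
    (Continuous.intervalIntegrable (by fun_prop) _ _ (μ := MeasureTheory.volume))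
    ((h.continuousOn_zetaRemainder_integrand hΩ).intervalIntegrable_of_Icc zero_le_one)
    fun s hs => h.le_slSol_sub_mul hΩ hle hs
  rw [intervalIntegral.integral_sub (Continuous.intervalIntegrable (by fun_prop) _ _)
    (Continuous.intervalIntegrable (by fun_prop) _ _), intervalIntegral.integral_const_mul,
    intervalIntegral.integral_const_mul, integral_pow_mul_one_sub_sq_pow,
    integral_pow_mul_one_sub_sq_pow] at hint
  refine lt_of_lt_of_le (sub_pos.2 ?_) hint
  simp only [Nat.ascFactorial_succ, Nat.ascFactorial_zero, Nat.factorial_succ, Nat.factorial_zero]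
  push_cast
  field_simp
  linarith

theorem continuousOn_slSol (h : IsRadialProfile f q c L) {a : ℝ} (ha : 0 < a) (n : ℕ)
    (hr : r ∈ Icc (0 : ℝ) 1) :
    ContinuousOn (fun Ω => slSol f n Ω r) {Ω | IsAdmissible f q n Ω ∧ kappa₂ f + a ≤ Ω} := by
  have hlip : LipschitzOnWith (L / a ^ 2 * (4 / 3) / (3 / 4)).toNNReal (fun Ω => slSol f n Ω r)
      {Ω | IsAdmissible f q n Ω ∧ kappa₂ f + a ≤ Ω} :=
    LipschitzOnWith.of_dist_le_mul fun Ω hΩ Ω' hΩ' => by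
      have hL := h.bound_nonneg
      rw [Real.coe_toNNReal _ (by positivity), Real.dist_eq, Real.dist_eq]
      exact (h.abs_slSol_sub_le ha hΩ.1 hΩ'.1 hΩ.2 hΩ'.2 hr).trans_eq (by ring)
  exact hlip.continuousOn

theorem continuousOn_zeta (h : IsRadialProfile f q c L) {a : ℝ} (ha : 0 < a) (n : ℕ) :
    ContinuousOn (zeta f n) {Ω | IsAdmissible f q n Ω ∧ kappa₂ f + a ≤ Ω} := by
  refine ((h.continuousOn_slSol ha n (right_mem_Icc.2 zero_le_one)).mul (by fun_prop)).add
    fun Ω hΩ => ?_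
  refine intervalIntegral.continuousWithinAt_of_dominated_interval
    (bound := fun _ => 4 / 3 * (L + 2)) ?_ ?_ intervalIntegrable_const ?_
  · filter_upwards [self_mem_nhdsWithin] with Ω' hΩ'
    exact ((((h.isVolterraSol_slSol hΩ'.1).continuousOn.mul (continuousOn_pow _)).mul
      (h.continuousOn.sub continuousOn_const)).intervalIntegrable_of_Icc
        zero_le_one).aestronglyMeasurable_restrict_uIoc
  · filter_upwards [self_mem_nhdsWithin] with Ω' hΩ'
    refine .of_forall fun s hs => ?_
    have hs' := Ioc_subset_Icc_self (uIoc_of_le (zero_le_one (α := ℝ)) ▸ hs)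
    have hF := h.slSol_mem_Icc hΩ'.1 hs'
    have hF0 : 0 ≤ slSol f n Ω' s := le_trans (by norm_num) hF.1
    have hpow := pow_nonneg hs'.1 (2 * n + 1)
    rw [Real.norm_eq_abs, abs_mul, abs_of_nonneg (mul_nonneg hF0 hpow)]
    exact mul_le_mul ((mul_le_of_le_one_right hF0 (pow_le_one₀ hs'.1 hs'.2)).trans hF.2)
      (h.abs_sub_two_mul_le hΩ'.1 hs') (abs_nonneg _) (by norm_num)
  · refine .of_forall fun s hs => ?_
    have hs' := Ioc_subset_Icc_self (uIoc_of_le (zero_le_one (α := ℝ)) ▸ hs)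
    exact (((h.continuousOn_slSol ha n hs').mul continuousOn_const).mul (by fun_prop)) Ω hΩ

end IsRadialProfile

end Mode

section Asymptotics

theorem eventually_lt_const_mul_natCast {b : ℝ} (hb : 0 < b) (A : ℝ) :
    ∀ᶠ m : ℕ in atTop, A < b * m :=
  (tendsto_natCast_atTop_atTop.const_mul_atTop hb).eventually_gt_atTop A

theorem eventually_div_sq_le_rpow_neg {α : ℝ} (hα : α < 2) (C : ℝ) :
    ∀ᶠ m : ℕ in atTop, C / (m : ℝ) ^ 2 ≤ (m : ℝ) ^ (-α) := by
  have hlim := (tendsto_rpow_atTop (sub_pos.2 hα)).comp (tendsto_natCast_atTop_atTop (R := ℝ))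
  filter_upwards [hlim.eventually_ge_atTop C, eventually_ge_atTop 1] with m hm hm1
  have hm0 : (0 : ℝ) < m := by exact_mod_cast hm1
  have hsplit : (m : ℝ) ^ (-α) * (m : ℝ) ^ 2 = (m : ℝ) ^ (2 - α) := by
    rw [← Real.rpow_two, ← Real.rpow_add hm0]
    ring_nf
  rw [div_le_iff₀ (by positivity), hsplit]
  exact hm

namespace IsRadialProfile

variable {f q : ℝ → ℝ} {c L : ℝ}

theorem exists_forall_abs_zetaRemainder_le (h : IsRadialProfile f q c L) {a : ℝ} (ha : 0 < a) :
    ∃ K > 0, ∀ m n : ℕ, 1 ≤ m → m ≤ n → ∀ Ω, IsAdmissible f q n Ω → kappa₂ f + a / m ≤ Ω →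
      |zetaRemainder f n Ω| ≤ K / m ^ 2 := by
  have hL := h.bound_pos
  refine ⟨L * (L + 2) / (6 * a), by positivity, fun m n hm hmn Ω hΩ ha_le => ?_⟩
  have : (0 : ℝ) < m := by exact_mod_cast hm
  have hmn' : (m : ℝ) ≤ n := by exact_mod_cast hmn
  have hgap : a / m ≤ Ω - kappa₂ f := by linarith
  have := sub_pos.2 hΩ.kappa₂_lt
  calc |zetaRemainder f n Ω|
      ≤ L * (L + 2) / (6 * (Ω - kappa₂ f) * ((n + 1) ^ 2 * (n + 2))) := h.abs_zetaRemainder_le hΩ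
    _ ≤ L * (L + 2) / (6 * (a / m) * (m ^ 2 * m)) := by
        gcongr <;> linarith
    _ = L * (L + 2) / (6 * a) / m ^ 2 := by field_simp

theorem le_omegaHat_sub_omegaHat (h : IsRadialProfile f q c L) (hneg : f 1 < 0) {m n : ℕ}
    (hm : 1 ≤ m) (hmn : 2 * m ≤ n) :
    -f 1 / 4 / m - L / m ^ 2 ≤ omegaHat f m - omegaHat f n := by
  have : (0 : ℝ) < m := by exact_mod_cast hm
  have hmn' : 2 * (m : ℝ) ≤ n := by exact_mod_cast hmn
  have hL := h.bound_nonneg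
  have lower := (h.omegaHat_sub_kappa₂_mem_Icc hm).1
  have upper := (h.omegaHat_sub_kappa₂_mem_Icc (n := n) (by lia)).2
  have hmain : -f 1 / (2 * n) ≤ -f 1 / (2 * (2 * m)) := by
    have := neg_pos.2 hneg
    gcongr
  have herror : L / (4 * n ^ 2) ≤ L / m ^ 2 := by
    gcongr
    nlinarith
  have hhalf : -f 1 / (2 * m) - -f 1 / (2 * (2 * m)) = -f 1 / 4 / m := by
    field_simp
    ring
  linarith

theorem eventually_mem_Icc_of_mem_Icc_omegaHat (h : IsRadialProfile f q c L) (hneg : f 1 < 0)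
    (C : ℝ) {ε : ℝ} (hε : 0 < ε) :
    ∀ᶠ m : ℕ in atTop, ∀ Ω ∈ Icc (omegaHat f m - C / m ^ 2) (omegaHat f m),
      Ω ∈ Icc (kappa₂ f + -f 1 / 4 / m) (kappa₂ f + ε) := by
  have hb := neg_pos.2 hneg
  filter_upwards [eventually_ge_atTop 1, eventually_lt_const_mul_natCast hb (4 * C),
    eventually_lt_const_mul_natCast hε (-f 1 + L)] with m hm hC hLε Ω hΩ
  have hm1 : (1 : ℝ) ≤ m := by exact_mod_cast hm
  have hL := h.bound_nonneg
  obtain ⟨lower, upper⟩ := h.omegaHat_sub_kappa₂_mem_Icc hm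
  have hleft : C / m ^ 2 ≤ -f 1 / (2 * m) - -f 1 / 4 / m := by
    rw [div_le_iff₀ (by positivity)]
    field_simp
    linarith
  have hright : -f 1 / (2 * m) + L / (4 * m ^ 2) ≤ ε := calc
    -f 1 / (2 * m) + L / (4 * m ^ 2) ≤ -f 1 / m + L / m := by
      gcongr <;> nlinarith
    _ ≤ ε := by
      rw [← add_div, div_le_iff₀ (by positivity)]
      exact hLε.le
  constructor <;> linarith [hΩ.1, hΩ.2]

theorem eventually_zetaRemainder_omegaHat_pos (h : IsRadialProfile f q c L) (hneg : f 1 < 0) :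
    ∀ᶠ m : ℕ in atTop, 0 < zetaRemainder f m (omegaHat f m) := by
  have hb : 0 < -f 1 / 4 := by linarith
  have hc := h.pos
  filter_upwards [eventually_ge_atTop 1, h.eventually_isAdmissible hb,
    h.eventually_mem_Icc_of_mem_Icc_omegaHat hneg 0 (ε := min 1 (c / 32)) (by positivity),
    eventually_lt_const_mul_natCast (b := c ^ 3 * (-f 1 / 4)) (by positivity)
      (96 * L ^ 3 * (1 + L))] with m hm hadm hmem hlarge
  have : (0 : ℝ) < m := by exact_mod_cast hm
  obtain ⟨lower, upper⟩ := hmem (omegaHat f m) (right_mem_Icc.2 (by simp))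
  have hΩ := hadm m _ le_rfl lower (upper.trans (by gcongr; exact min_le_left _ _))
  have := sub_pos.2 hΩ.kappa₂_lt
  refine h.zetaRemainder_pos hΩ (upper.trans (by gcongr; exact min_le_right _ _)) ?_
  calc 96 * L ^ 3 * (1 + L) < c ^ 3 * (-f 1 / 4) * m := hlarge
    _ = c ^ 3 * (-f 1 / 4 / m) * (m * m) := by field_simp
    _ ≤ c ^ 3 * (omegaHat f m - kappa₂ f) * ((m + 3) * (m + 4)) := by
      gcongr <;> linarith

theorem exists_zeta_eq_zero (h : IsRadialProfile f q c L) {a δ : ℝ} {m : ℕ} (hm : 1 ≤ m)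
    (ha : 0 < a) (hadm : ∀ Ω ∈ Icc (omegaHat f m - δ) (omegaHat f m),
      IsAdmissible f q m Ω ∧ kappa₂ f + a ≤ Ω)
    (hpos : 0 < zetaRemainder f m (omegaHat f m))
    (hlt : 4 * |zetaRemainder f m (omegaHat f m - δ)| < δ) :
    ∃ Ω ∈ Ioo (omegaHat f m - δ) (omegaHat f m), zeta f m Ω = 0 := by
  have hle : omegaHat f m - δ ≤ omegaHat f m := by
    linarith [abs_nonneg (zetaRemainder f m (omegaHat f m - δ))]
  have hleft : zeta f m (omegaHat f m - δ) < 0 :=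
    h.zeta_neg_of_lt hm (hadm _ (left_mem_Icc.2 hle)).1 (by rwa [sub_sub_cancel])
  have hright : 0 < zeta f m (omegaHat f m) := by
    rwa [h.zeta_eq hm (hadm _ (right_mem_Icc.2 hle)).1, sub_self, mul_zero, mul_zero, zero_add]
  exact intermediate_value_Ioo hle ((h.continuousOn_zeta ha m).mono hadm) ⟨hleft, hright⟩

theorem eventually_exists_zeta_eq_zero (h : IsRadialProfile f q c L) (hneg : f 1 < 0) :
    ∃ C, ∀ᶠ m : ℕ in atTop, ∃ Ω ∈ Ioo (omegaHat f m - C / m ^ 2) (omegaHat f m),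
      zeta f m Ω = 0 ∧ (∀ n, m ≤ n → IsAdmissible f q n Ω) ∧
        ∀ n, 2 * m ≤ n → omegaHat f n < Ω ∧ 0 < zeta f n Ω := by
  have hb : 0 < -f 1 / 4 := by linarith
  obtain ⟨K, hK0, hK⟩ := h.exists_forall_abs_zetaRemainder_le hb
  refine ⟨5 * K, ?_⟩
  filter_upwards [eventually_ge_atTop 1, h.eventually_isAdmissible hb,
    h.eventually_mem_Icc_of_mem_Icc_omegaHat hneg (5 * K) zero_lt_one,
    h.eventually_zetaRemainder_omegaHat_pos hneg,
    eventually_lt_const_mul_natCast hb (9 * K + L)] with m hm hadm hmem hpos hlarge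
  have hm0 : (0 : ℝ) < m := by exact_mod_cast hm
  have hm2 : 0 < K / m ^ 2 := by positivity
  have hadm' : ∀ Ω ∈ Icc (omegaHat f m - 5 * K / m ^ 2) (omegaHat f m), ∀ n, m ≤ n →
      IsAdmissible f q n Ω := fun Ω hΩ n hn => hadm n Ω hn (hmem Ω hΩ).1 (hmem Ω hΩ).2
  have hleft : omegaHat f m - 5 * K / m ^ 2 ∈ Icc (omegaHat f m - 5 * K / m ^ 2) (omegaHat f m) :=
    left_mem_Icc.2 (sub_le_self _ (by positivity))
  obtain ⟨Ω, hΩ, hzero⟩ := h.exists_zeta_eq_zero hm (by positivity : 0 < -f 1 / 4 / m)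
    (fun Ω hΩ => ⟨hadm' Ω hΩ m le_rfl, (hmem Ω hΩ).1⟩) hpos (by
      have hrem := hK m m hm le_rfl _ (hadm' _ hleft m le_rfl) (hmem _ hleft).1
      calc _ ≤ 4 * (K / m ^ 2) := by gcongr
        _ < 5 * K / m ^ 2 := by rw [mul_div_assoc]; gcongr; norm_num)
  have hΩ' := Ioo_subset_Icc_self hΩ
  refine ⟨Ω, hΩ, hzero, hadm' Ω hΩ', fun n hn => ?_⟩
  have hmn : m ≤ n := by lia
  have hrem := hK m n hm hmn Ω (hadm' Ω hΩ' n hmn) (hmem Ω hΩ').1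
  have hgap : 4 * (K / m ^ 2) < Ω - omegaHat f n := by
    have hlow : (9 * K + L) / m ^ 2 < -f 1 / 4 / m := by
      rw [div_lt_div_iff₀ (by positivity) hm0]
      nlinarith
    have hhat := h.le_omegaHat_sub_omegaHat hneg hm hn
    have hsplit : (9 * K + L) / m ^ 2 = 4 * (K / m ^ 2) + 5 * K / m ^ 2 + L / m ^ 2 := by ring
    linarith [hΩ.1]
  exact ⟨by linarith, h.zeta_pos_of_lt (hm.trans hmn) (hadm' Ω hΩ' n hmn) (by linarith)⟩

end IsRadialProfile

end Asymptotics

end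

end RotatingVortex

theorem proposition4p8_general {f₀ g : ℝ → ℝ} {c α : ℝ} (hg : ContDiffOn ℝ 1 g (Set.Icc 0 1))
    (hfg : ∀ r ∈ Set.Icc (0 : ℝ) 1, f₀ r = g (r ^ 2)) (hc : 0 < c)
    (hinc : ∀ r ∈ Set.Ioc (0 : ℝ) 1, c ≤ derivWithin f₀ (Set.Icc 0 1) r / r) (hneg : f₀ 1 < 0)
    (hα : α < 2) :
    ∃ m₀ : ℕ, 1 ≤ m₀ ∧ ∀ m : ℕ, m₀ ≤ m →
      ∃ Ω : ℝ,
        Ω ∈ Set.Ioo (RotatingVortex.omegaHat f₀ m - (m : ℝ) ^ (-α))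
          (RotatingVortex.omegaHat f₀ m) ∧
        RotatingVortex.kappa₂ f₀ < Ω ∧
        (∀ n : ℕ, 1 ≤ n → RotatingVortex.HasUniqueSturmLiouvilleSol f₀ (n * m) Ω) ∧
        RotatingVortex.zeta f₀ m Ω = 0 ∧
        (∀ n : ℕ, 1 ≤ n → Ω ≠ RotatingVortex.omegaHat f₀ (n * m)) ∧
        (∀ n : ℕ, 2 ≤ n → RotatingVortex.zeta f₀ (n * m) Ω ≠ 0) := by
  open RotatingVortex in
  obtain ⟨q, L, h⟩ := exists_isRadialProfile hg hfg hc hinc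
  obtain ⟨C, hC⟩ := h.eventually_exists_zeta_eq_zero hneg
  obtain ⟨m₀, H⟩ := Filter.eventually_atTop.1 (hC.and (eventually_div_sq_le_rpow_neg hα C))
  refine ⟨max 1 m₀, le_max_left _ _, fun m hm => ?_⟩
  obtain ⟨⟨Ω, hΩ, hzero, hadm, hlarge⟩, hrate⟩ := H m (le_of_max_le_right hm)
  refine ⟨Ω, ⟨by linarith [hΩ.1], hΩ.2⟩, (hadm m le_rfl).kappa₂_lt,
    fun n hn => h.hasUniqueSturmLiouvilleSol (hadm _ (Nat.le_mul_of_pos_left m hn)), hzero,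
    fun n hn => ?_, fun n hn => (hlarge _ (Nat.mul_le_mul_right m hn)).2.ne'⟩
  rcases hn.eq_or_lt with rfl | hn
  · rw [one_mul]
    exact hΩ.2.ne
  · exact (hlarge _ (Nat.mul_le_mul_right m hn)).1.ne'

theorem proposition4p8 (f₀ : ℝ → ℝ) (hf₀ : RotatingVortex.IsProfile f₀)
    (hneg : ∀ r ∈ Set.Icc (0 : ℝ) 1, f₀ r < 0)
    (α : ℝ) (hα : α ∈ Set.Ioo (1 : ℝ) 2) :
    ∃ m₀ : ℕ, 1 ≤ m₀ ∧ ∀ m : ℕ, m₀ ≤ m →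
      ∃ Ω : ℝ,
        Ω ∈ Set.Ioo (RotatingVortex.omegaHat f₀ m - (m : ℝ) ^ (-α))
          (RotatingVortex.omegaHat f₀ m) ∧
        -- `ζ_{nm}` is genuinely defined at `Ω`
        RotatingVortex.kappa₂ f₀ < Ω ∧
        (∀ n : ℕ, 1 ≤ n → RotatingVortex.HasUniqueSturmLiouvilleSol f₀ (n * m) Ω) ∧
        RotatingVortex.zeta f₀ m Ω = 0 ∧
        (∀ n : ℕ, 1 ≤ n → Ω ≠ RotatingVortex.omegaHat f₀ (n * m)) ∧
        (∀ n : ℕ, 2 ≤ n → RotatingVortex.zeta f₀ (n * m) Ω ≠ 0) := by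
  obtain ⟨_, g, _, _, hg, hfg⟩ := hf₀.regular
  obtain ⟨c, hc, hinc⟩ := hf₀.increasing
  exact proposition4p8_general (hg.1.of_le one_le_two) hfg hc hinc
    (hneg 1 (Set.right_mem_Icc.2 zero_le_one)) hα.2
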